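/- Let $\mathbf{W^*}$ be the category whose objects are the unital $C^*$-algebras that are the dual of a Banach space (the predual), and whose morphisms are the unital normal (that is, $w^*$-continuous) $*$-homomorphisms; let $\mathbf{cW^*}$ be its full subcategory of commutative algebras. A categorical tensor product of $\mathcal M,\mathcal N\in\mathbf{W^*}$ is an object $\mathcal M\,\tilde\otimes\,\mathcal N$ with morphisms from $\mathcal M$ and from $\mathcal N$ whose images commute elementwise, universal among all such pairs of morphisms into a $W^*$-algebra (equivalently, the free product modulo the $w^*$-closed ideal generated by the commutators of elements of $\mathcal M$ with elements of $\mathcal N$). Let $\mathbb T$ be the unit circle with Lebesgue measure $\lambda$, and for $w\in\mathbb T$ let $\rho_w$ be the automorphism $(\rho_wf)(z)=f(w^{-1}z)$ of $L^\infty(\mathbb T,\lambda)$. (0) All categorical tensor products $\mathcal M\,\tilde\otimes\,\mathcal N$ exist, and $\mathcal M\,\tilde\otimes\,\mathcal N$ is commutative if $\mathcal M$ and $\mathcal N$ are. So for every choice of tensor products $-\,\tilde\otimes\,L^\infty(\mathbb T,\lambda)$ is a functor $\mathbf{W^*}\to\mathbf{W^*}$, which restricts to a functor $\mathbf{cW^*}\to\mathbf{cW^*}$.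 (1) If $w=e^{2\pi i\theta}$ with $\theta$ irrational, then the inclusion $\iota:\mathbb C\to L^\infty(\mathbb T,\lambda)$ is the equalizer of $\rho_w$ and the identity, both in $\mathbf{W^*}$ and in $\mathbf{cW^*}$. (2) For every such $w$, $\iota\,\tilde\otimes\,1$ is not an equalizer of $\rho_w\,\tilde\otimes\,1$ and $1\,\tilde\otimes\,1$, neither in $\mathbf{W^*}$ nor in $\mathbf{cW^*}$. Hence the functors $-\,\tilde\otimes\,L^\infty(\mathbb T,\lambda)$ on $\mathbf{W^*}$ and on $\mathbf{cW^*}$ do not preserve equalizers; in particular they do not preserve limits. (3) Neither of these two functors has a left adjoint. (4) $\mathbf{cW^*}$ has binary coproducts $\amalg$ but fails to have all coexponentials: with $\mathcal Y=L^\infty(\mathbb T,\lambda)$ there is $\mathcal Z\in\mathbf{cW^*}$ for which there is no object $\mathcal E\in\mathbf{cW^*}$ with a morphism $e:\mathcal Z\to\mathcal E\amalg\mathcal Y$ such that every morphism $f:\mathcal Z\to\mathcal X\amalg\mathcal Y$ in $\mathbf{cW^*}$ is $f=(g\amalg 1_{\mathcal Y})\circ e$ for a unique $g:\mathcal E\to\mathcal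 X$. -/

import Mathlib

open MeasureTheory CategoryTheory CategoryTheory.Limits
open scoped ENNReal Topology

noncomputable section

namespace LinftyAlg

variable {α : Type} [MeasurableSpace α] {μ : Measure α}

instance instMul : Mul (Lp ℂ ∞ μ) where
  mul f g := ⟨(f : α →ₘ[μ] ℂ) * (g : α →ₘ[μ] ℂ), by
    have h : MemLp ((f : α → ℂ) * (g : α → ℂ)) ∞ μ := (Lp.memLp g).mul (Lp.memLp f)
    have e : (f : α →ₘ[μ] ℂ) * (g : α →ₘ[μ] ℂ) = AEEqFun.mk _ h.1 := by
      rw [← AEEqFun.mk_mul_mk _ _ (Lp.aestronglyMeasurable f) (Lp.aestronglyMeasurable g),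
        AEEqFun.mk_coeFn, AEEqFun.mk_coeFn]
    rw [e]
    exact (h.toLp _).2⟩

instance instOne : One (Lp ℂ ∞ μ) where
  one := ⟨(1 : α →ₘ[μ] ℂ), (MemLp.toLp (fun _ => (1 : ℂ)) (memLp_top_const 1)).2⟩

theorem coe_mul (f g : Lp ℂ ∞ μ) :
    ((f * g : Lp ℂ ∞ μ) : α →ₘ[μ] ℂ) = (f : α →ₘ[μ] ℂ) * (g : α →ₘ[μ] ℂ) := rfl

theorem coe_one : ((1 : Lp ℂ ∞ μ) : α →ₘ[μ] ℂ) = 1 := rfl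

theorem coeFn_mul (f g : Lp ℂ ∞ μ) : ⇑(f * g) =ᵐ[μ] fun x => f x * g x :=
  AEEqFun.coeFn_mul _ _

theorem coeFn_one : ⇑(1 : Lp ℂ ∞ μ) =ᵐ[μ] fun _ => 1 := AEEqFun.coeFn_one

theorem mul_comm' (f g : Lp ℂ ∞ μ) : f * g = g * f :=
  Subtype.ext (mul_comm (f : α →ₘ[μ] ℂ) g)

theorem mul_add' (f g h : Lp ℂ ∞ μ) : f * (g + h) = f * g + f * h := by
  apply Lp.ext
  filter_upwards [coeFn_mul f (g + h), Lp.coeFn_add g h, Lp.coeFn_add (f * g) (f * h),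
    coeFn_mul f g, coeFn_mul f h] with x h1 h2 h3 h4 h5
  rw [h1, h2, h3, Pi.add_apply, Pi.add_apply, h4, h5, mul_add]

theorem mul_zero' (f : Lp ℂ ∞ μ) : f * 0 = 0 := by
  apply Lp.ext
  filter_upwards [coeFn_mul f 0, Lp.coeFn_zero ℂ ∞ μ] with x h1 h2
  rw [h1, h2, Pi.zero_apply, mul_zero]

theorem ae_le_norm (f : Lp ℂ ∞ μ) : ∀ᵐ x ∂μ, ‖f x‖ ≤ ‖f‖ := by
  filter_upwards [enorm_ae_le_eLpNormEssSup f μ] with x hx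
  rw [Lp.norm_def, ← eLpNorm_exponent_top, ← toReal_enorm] at *
  exact ENNReal.toReal_mono (Lp.eLpNorm_ne_top f) hx

theorem norm_le_of_ae_le {f : Lp ℂ ∞ μ} {C : ℝ} (hC : 0 ≤ C) (h : ∀ᵐ x ∂μ, ‖f x‖ ≤ C) :
    ‖f‖ ≤ C := by
  rw [Lp.norm_def, eLpNorm_exponent_top]
  exact ENNReal.toReal_le_of_le_ofReal hC (eLpNormEssSup_le_of_ae_bound h)

theorem norm_mul_le' (f g : Lp ℂ ∞ μ) : ‖f * g‖ ≤ ‖f‖ * ‖g‖ := by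
  have h : (f * g) = (f • g : Lp ℂ ∞ μ) := by
    apply Lp.ext
    filter_upwards [coeFn_mul f g, Lp.coeFn_lpSMul (r := ∞) f g] with x h1 h2
    rw [h1, h2]; rfl
  rw [h]
  exact Lp.norm_smul_le f g

instance instNormedCommRing : NormedCommRing (Lp ℂ ∞ μ) :=
  { (inferInstance : NormedAddCommGroup (Lp ℂ ∞ μ)) with
    mul := (· * ·)
    one := 1
    mul_assoc := fun a b c => Subtype.ext (mul_assoc (a : α →ₘ[μ] ℂ) b c)
    one_mul := fun a => Subtype.ext (one_mul (a : α →ₘ[μ] ℂ))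
    mul_one := fun a => Subtype.ext (mul_one (a : α →ₘ[μ] ℂ))
    left_distrib := mul_add'
    right_distrib := fun a b c => by rw [mul_comm', mul_add', mul_comm' c a, mul_comm' c b]
    zero_mul := fun a => by rw [mul_comm', mul_zero']
    mul_zero := mul_zero'
    mul_comm := mul_comm'
    norm_mul_le := norm_mul_le' }

instance instStarRing : StarRing (Lp ℂ ∞ μ) where
  star_mul f g := by
    apply Lp.ext
    filter_upwards [Lp.coeFn_star (f * g), coeFn_mul f g, coeFn_mul (star g) (star f),
      Lp.coeFn_star f, Lp.coeFn_star g] with x h1 h2 h3 h4 h5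
    rw [h1, h3, h4, h5, Pi.star_apply, Pi.star_apply, Pi.star_apply, h2, star_mul]
  star_add f g := by
    apply Lp.ext
    filter_upwards [Lp.coeFn_star (f + g), Lp.coeFn_add f g, Lp.coeFn_add (star f) (star g),
      Lp.coeFn_star f, Lp.coeFn_star g] with x h1 h2 h3 h4 h5
    rw [h1, h3, Pi.add_apply, h4, h5, Pi.star_apply, Pi.star_apply, Pi.star_apply, h2,
      Pi.add_apply, star_add]

instance instNormedAlgebra : NormedAlgebra ℂ (Lp ℂ ∞ μ) :=
  { Algebra.ofModule (R := ℂ) (A := Lp ℂ ∞ μ)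
      (fun c f g => by
        apply Lp.ext
        filter_upwards [coeFn_mul (c • f) g, Lp.coeFn_smul c f, Lp.coeFn_smul c (f * g),
          coeFn_mul f g] with x h1 h2 h3 h4
        rw [h1, h2, h3, Pi.smul_apply, Pi.smul_apply, h4, smul_mul_assoc])
      (fun c f g => by
        apply Lp.ext
        filter_upwards [coeFn_mul f (c • g), Lp.coeFn_smul c g, Lp.coeFn_smul c (f * g),
          coeFn_mul f g] with x h1 h2 h3 h4
        rw [h1, h2, h3, Pi.smul_apply, Pi.smul_apply, h4, mul_smul_comm]) with
    norm_smul_le := norm_smul_le }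

instance instStarModule : StarModule ℂ (Lp ℂ ∞ μ) where
  star_smul c f := by
    apply Lp.ext
    filter_upwards [Lp.coeFn_star (c • f), Lp.coeFn_smul c f, Lp.coeFn_smul (star c) (star f),
      Lp.coeFn_star f] with x h1 h2 h3 h4
    rw [h1, h3, Pi.star_apply, h2, Pi.smul_apply, Pi.smul_apply, h4, star_smul, Pi.star_apply]

instance instCStarRing : CStarRing (Lp ℂ ∞ μ) where
  norm_mul_self_le f := by
    have key : ∀ᵐ x ∂μ, ‖f x‖ ≤ Real.sqrt ‖star f * f‖ := by
      filter_upwards [coeFn_mul (star f) f, Lp.coeFn_star f,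
        ae_le_norm (star f * f)] with x h1 h2 h3
      apply Real.le_sqrt_of_sq_le
      rw [h1, h2, Pi.star_apply, norm_mul, norm_star] at h3
      rw [sq]; exact h3
    have hle : ‖f‖ ≤ Real.sqrt ‖star f * f‖ := norm_le_of_ae_le (Real.sqrt_nonneg _) key
    calc ‖f‖ * ‖f‖ ≤ Real.sqrt ‖star f * f‖ * Real.sqrt ‖star f * f‖ :=
          mul_self_le_mul_self (norm_nonneg _) hle
      _ = _ := Real.mul_self_sqrt (norm_nonneg _)

instance instCommCStarAlgebra : CommCStarAlgebra (Lp ℂ ∞ μ) where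

end LinftyAlg

/-! ### The category of W*-algebras -/

/-- A W*-algebra: a unital C*-algebra `carrier` together with a complex Banach space `predual`
and an isometric linear identification of `carrier` with the dual of `predual`.
The zero algebra is allowed. -/
structure WStar where
  carrier : Type
  [cstarAlgebra : CStarAlgebra carrier]
  predual : Type
  [normedAddCommGroup : NormedAddCommGroup predual]
  [normedSpace : NormedSpace ℂ predual]
  [completeSpace : CompleteSpace predual]
  dualEquiv : carrier ≃ₗᵢ[ℂ] StrongDual ℂ predual

namespace WStar

attribute [instance] cstarAlgebra normedAddCommGroup normedSpace completeSpace

/-- The underlying C*-algebra is a W*-algebra in the sense of Mathlib. -/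
theorem wStarAlgebra (M : WStar) : WStarAlgebra M.carrier where
  exists_predual := ⟨M.predual, inferInstance, inferInstance, inferInstance,
    ⟨M.dualEquiv.symm.trans (starₗᵢ ℂ)⟩⟩

/-- Conversely, every W*-algebra in the sense of Mathlib is isomorphic to an object. -/
theorem exists_of_wStarAlgebra (A : Type) [CStarAlgebra A] [h : WStarAlgebra A] :
    ∃ M : WStar, Nonempty (A ≃⋆ₐ[ℂ] M.carrier) := by
  obtain ⟨X, _, _, _, ⟨e⟩⟩ := h.exists_predual
  exact ⟨⟨A, X, (starₗᵢ ℂ).trans e.symm⟩, ⟨StarAlgEquiv.refl ℂ A⟩⟩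

/-- The `w*`-topology `σ(M, M_*)` on a W*-algebra. -/
@[reducible] def weakStarTopology (M : WStar) : TopologicalSpace M.carrier :=
  TopologicalSpace.induced (fun m => StrongDual.toWeakDual (M.dualEquiv m)) inferInstance

/-- Morphisms of W*-algebras: unital `*`-homomorphisms that are normal, that is, continuous for
the `w*`-topologies. -/
structure Hom (M N : WStar) where
  toStarAlgHom : M.carrier →⋆ₐ[ℂ] N.carrier
  normal : Continuous[M.weakStarTopology, N.weakStarTopology] toStarAlgHom

theorem Hom.ext' {M N : WStar} {f g : Hom M N}
    (h : ∀ m, f.toStarAlgHom m = g.toStarAlgHom m) : f = g := by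
  obtain ⟨f, hf⟩ := f
  obtain ⟨g, hg⟩ := g
  have : f = g := StarAlgHom.ext h
  subst this
  rfl

instance instCategory : Category WStar where
  Hom := Hom
  id M := ⟨StarAlgHom.id ℂ M.carrier, @continuous_id _ M.weakStarTopology⟩
  comp {M N R} f g := ⟨g.toStarAlgHom.comp f.toStarAlgHom,
    @Continuous.comp _ _ _ M.weakStarTopology N.weakStarTopology R.weakStarTopology
      _ _ g.normal f.normal⟩

instance instCoeFunHom (M N : WStar) : CoeFun (M ⟶ N) fun _ => M.carrier → N.carrier where
  coe f := f.toStarAlgHom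

@[ext]
theorem hom_ext {M N : WStar} {f g : M ⟶ N} (h : ∀ m, f m = g m) : f = g := Hom.ext' h

@[simp]
theorem id_apply (M : WStar) (m : M.carrier) : (𝟙 M : M ⟶ M) m = m := rfl

@[simp]
theorem comp_apply {M N R : WStar} (f : M ⟶ N) (g : N ⟶ R) (m : M.carrier) :
    (f ≫ g) m = g (f m) := rfl

theorem continuous_eval (M : WStar) (x : M.predual) :
    Continuous[M.weakStarTopology, inferInstance] fun m => M.dualEquiv m x := by
  let := M.weakStarTopology
  exact (WeakDual.eval_continuous x).comp continuous_induced_dom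

theorem normal_iff {M N : WStar} (f : M.carrier → N.carrier) :
    Continuous[M.weakStarTopology, N.weakStarTopology] f ↔
      ∀ y : N.predual, Continuous[M.weakStarTopology, inferInstance]
        fun m => N.dualEquiv (f m) y := by
  let := M.weakStarTopology
  let := N.weakStarTopology
  constructor
  · intro h y
    exact (N.continuous_eval y).comp h
  · intro h
    exact continuous_induced_rng.2 (WeakDual.continuous_of_continuous_eval h)

/-- Commutativity of a W*-algebra. -/
def isCommutative : ObjectProperty WStar := fun M => ∀ a b : M.carrier, a * b = b * a

/-! ### The categorical tensor product -/

/-- A categorical tensor product of `M` and `N`: a W*-algebra `pt` with morphisms from `M` and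
`N` whose images commute elementwise, universal among all such pairs of morphisms. -/
structure CategoricalTensor (M N : WStar) where
  pt : WStar
  inl : M ⟶ pt
  inr : N ⟶ pt
  commute : ∀ (m : M.carrier) (n : N.carrier), inl m * inr n = inr n * inl m
  existsUnique_desc : ∀ (R : WStar) (f : M ⟶ R) (g : N ⟶ R),
    (∀ (m : M.carrier) (n : N.carrier), f m * g n = g n * f m) →
      ∃! h : pt ⟶ R, inl ≫ h = f ∧ inr ≫ h = g

namespace CategoricalTensor

variable {M M' N : WStar}

/-- The morphism induced by a pair of morphisms with commuting images. -/
def desc (T : CategoricalTensor M N) {R : WStar} (f : M ⟶ R) (g : N ⟶ R)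
    (h : ∀ (m : M.carrier) (n : N.carrier), f m * g n = g n * f m) : T.pt ⟶ R :=
  (T.existsUnique_desc R f g h).choose

theorem inl_desc (T : CategoricalTensor M N) {R : WStar} (f : M ⟶ R) (g : N ⟶ R)
    (h : ∀ (m : M.carrier) (n : N.carrier), f m * g n = g n * f m) :
    T.inl ≫ T.desc f g h = f :=
  (T.existsUnique_desc R f g h).choose_spec.1.1

theorem inr_desc (T : CategoricalTensor M N) {R : WStar} (f : M ⟶ R) (g : N ⟶ R)
    (h : ∀ (m : M.carrier) (n : N.carrier), f m * g n = g n * f m) :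
    T.inr ≫ T.desc f g h = g :=
  (T.existsUnique_desc R f g h).choose_spec.1.2

theorem hom_ext (T : CategoricalTensor M N) {R : WStar} {h k : T.pt ⟶ R}
    (hl : T.inl ≫ h = T.inl ≫ k) (hr : T.inr ≫ h = T.inr ≫ k) : h = k := by
  have hc : ∀ (m : M.carrier) (n : N.carrier),
      (T.inl ≫ k) m * (T.inr ≫ k) n = (T.inr ≫ k) n * (T.inl ≫ k) m := fun m n => by
    rw [comp_apply, comp_apply, ← map_mul, ← map_mul, T.commute]
  exact (T.existsUnique_desc R _ _ hc).unique ⟨hl, hr⟩ ⟨rfl, rfl⟩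

/-- The morphism `f ⊗ 1`. -/
def mapLeft (T : CategoricalTensor M N) (T' : CategoricalTensor M' N) (f : M ⟶ M') :
    T.pt ⟶ T'.pt :=
  T.desc (f ≫ T'.inl) T'.inr fun m n => by rw [comp_apply, T'.commute]

theorem inl_mapLeft (T : CategoricalTensor M N) (T' : CategoricalTensor M' N) (f : M ⟶ M') :
    T.inl ≫ T.mapLeft T' f = f ≫ T'.inl :=
  T.inl_desc _ _ _

theorem inr_mapLeft (T : CategoricalTensor M N) (T' : CategoricalTensor M' N) (f : M ⟶ M') :
    T.inr ≫ T.mapLeft T' f = T'.inr :=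
  T.inr_desc _ _ _

end CategoricalTensor

/-- The functor `- ⊗ N`, for a given choice `T` of the categorical tensor products `M ⊗ N`:
it sends `M` to `M ⊗ N` and `f` to `f ⊗ 1`. -/
def tensorRight {N : WStar} (T : ∀ M, CategoricalTensor M N) : WStar ⥤ WStar where
  obj M := (T M).pt
  map f := (T _).mapLeft (T _) f
  map_id M := (T M).hom_ext
    (by rw [CategoricalTensor.inl_mapLeft, Category.id_comp, Category.comp_id])
    (by rw [CategoricalTensor.inr_mapLeft, Category.comp_id])
  map_comp {M M' M''} f g := (T M).hom_ext
    (by rw [CategoricalTensor.inl_mapLeft, ← Category.assoc, CategoricalTensor.inl_mapLeft,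
      Category.assoc, Category.assoc, CategoricalTensor.inl_mapLeft])
    (by rw [CategoricalTensor.inr_mapLeft, ← Category.assoc, CategoricalTensor.inr_mapLeft,
      CategoricalTensor.inr_mapLeft])

/-! ### The W*-algebra of complex numbers -/

/-- `ℂ` as a W*-algebra. -/
abbrev complex : WStar where
  carrier := ℂ
  predual := ℂ
  dualEquiv := ContinuousLinearMap.toSpanSingletonLIE ℂ ℂ

/-- The unital inclusion of `ℂ` into a W*-algebra. -/
def unit (M : WStar) : complex ⟶ M where
  toStarAlgHom := (StarAlgHom.ofId ℂ M.carrier : ℂ →⋆ₐ[ℂ] M.carrier)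
  normal := by
    rw [normal_iff]
    intro y
    convert complex.continuous_eval (M.dualEquiv 1 y : ℂ) using 2 with c
    have h1 : (StarAlgHom.ofId ℂ M.carrier : ℂ →⋆ₐ[ℂ] M.carrier) c = c • (1 : M.carrier) :=
      Algebra.algebraMap_eq_smul_one c
    have h2 : complex.dualEquiv c (M.dualEquiv 1 y : ℂ) = (M.dualEquiv 1 y : ℂ) • c := rfl
    rw [h1, h2, map_smul, smul_eq_mul, mul_comm]
    rfl

theorem unit_comp {M N : WStar} (f : M ⟶ N) : unit M ≫ f = unit N := by
  ext c
  exact f.toStarAlgHom.toAlgHom.commutes c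

/-! ### `L^∞` of a finite measure as the dual of `L^1` -/

section Linfty

variable {α : Type} [MeasurableSpace α] (μ : Measure α)

/-- The pairing `⟨h, f⟩ = ∫ h f dμ` of `L^∞` with `L^1`. -/
def linftyPairing : Lp ℂ ∞ μ →L[ℂ] StrongDual ℂ (Lp ℂ 1 μ) :=
  ContinuousLinearMap.lpPairing μ ∞ 1 (ContinuousLinearMap.mul ℂ ℂ)

theorem linftyPairing_apply (h : Lp ℂ ∞ μ) (f : Lp ℂ 1 μ) :
    linftyPairing μ h f = ∫ x, h x * f x ∂μ :=
  ContinuousLinearMap.lpPairing_eq_integral _ _ _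

variable {μ}

theorem ae_norm_le_of_integral_le [IsFiniteMeasure μ] {h : α → ℂ} (hm : StronglyMeasurable h)
    (hi : Integrable h μ) (C : ℝ)
    (H : ∀ f : α → ℂ, StronglyMeasurable f → (∀ x, ‖f x‖ ≤ 1) →
      ‖∫ x, h x * f x ∂μ‖ ≤ C * ∫ x, ‖f x‖ ∂μ) :
    ∀ᵐ x ∂μ, ‖h x‖ ≤ C := by
  set g : α → ℂ := fun x => (starRingEnd ℂ) (h x) / (‖h x‖ : ℂ) with hg
  have hgm : Measurable g := by
    have := hm.measurable
    fun_prop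
  have hg1 : ∀ x, ‖g x‖ ≤ 1 := fun x => by
    simp only [hg, norm_div, RCLike.norm_conj, Complex.norm_real, norm_norm]
    exact div_self_le_one _
  have hhg : ∀ x, h x * g x = (‖h x‖ : ℂ) := fun x => by
    simp only [hg]
    rw [← mul_div_assoc, Complex.mul_conj, Complex.normSq_eq_norm_sq]
    by_cases h0 : ‖h x‖ = 0
    · simp [h0]
    · have : (‖h x‖ : ℂ) ≠ 0 := by exact_mod_cast h0
      push_cast
      field_simp
  apply ae_le_of_forall_setIntegral_le hi.norm (integrable_const C)
  intro s hs _
  have key := H (s.indicator g) (hgm.indicator hs).stronglyMeasurable (fun x => by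
    by_cases hx : x ∈ s
    · simpa [hx] using hg1 x
    · simp [hx])
  have e1 : ∫ x, h x * s.indicator g x ∂μ = ((∫ x in s, ‖h x‖ ∂μ : ℝ) : ℂ) := by
    rw [← integral_complex_ofReal, ← integral_indicator hs]
    congr 1
    funext x
    by_cases hx : x ∈ s
    · simp [hx, hhg x]
    · simp [hx]
  have e2 : ∫ x, ‖s.indicator g x‖ ∂μ ≤ ∫ x, s.indicator (fun _ => (1 : ℝ)) x ∂μ := by
    apply integral_mono_of_nonneg (.of_forall fun _ => norm_nonneg _)
    · exact (integrable_const (1 : ℝ)).indicator hs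
    · refine .of_forall fun x => ?_
      by_cases hx : x ∈ s
      · simpa [hx] using hg1 x
      · simp [hx]
  have hC : 0 ≤ C ∨ μ = 0 := by
    by_contra hcon
    rw [not_or] at hcon
    have h1 := H (fun _ => 1) stronglyMeasurable_const (fun x => by simp)
    have h2 : 0 < μ.real Set.univ := by
      rw [Measure.real, ENNReal.toReal_pos_iff]
      exact ⟨(Measure.measure_univ_pos).2 hcon.2, measure_lt_top _ _⟩
    have h3 := (norm_nonneg _).trans h1
    simp at h3
    nlinarith
  rcases hC with hC | hC
  · rw [e1, Complex.norm_real, Real.norm_of_nonneg (integral_nonneg fun _ => norm_nonneg _)] at key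
    rw [integral_indicator hs] at e2
    calc ∫ x in s, ‖h x‖ ∂μ ≤ C * ∫ x, ‖s.indicator g x‖ ∂μ := key
      _ ≤ C * ∫ x in s, (1 : ℝ) ∂μ := mul_le_mul_of_nonneg_left e2 hC
      _ = ∫ x in s, C ∂μ := by rw [← integral_const_mul]; simp
  · simp [hC]

theorem linftyPairing_norm [IsFiniteMeasure μ] (h : Lp ℂ ∞ μ) : ‖linftyPairing μ h‖ = ‖h‖ := by
  apply le_antisymm
  · refine ContinuousLinearMap.opNorm_le_bound _ (norm_nonneg _) fun f => ?_
    rw [linftyPairing_apply, L1.norm_eq_integral_norm, ← integral_const_mul]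
    refine norm_integral_le_of_norm_le ((L1.integrable_coeFn f).norm.const_mul _) ?_
    filter_upwards [LinftyAlg.ae_le_norm h] with x hx
    rw [norm_mul]
    exact mul_le_mul_of_nonneg_right hx (norm_nonneg _)
  · apply LinftyAlg.norm_le_of_ae_le (norm_nonneg _)
    apply ae_norm_le_of_integral_le (Lp.stronglyMeasurable h)
      ((Lp.memLp h).integrable le_top)
    intro f hf hf1
    have hfm : MemLp f 1 μ := (memLp_top_of_bound hf.aestronglyMeasurable 1
      (.of_forall hf1)).mono_exponent le_top
    have := (linftyPairing μ h).le_opNorm (hfm.toLp f)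
    rw [linftyPairing_apply, L1.norm_eq_integral_norm] at this
    rw [integral_congr_ae (g := fun x => h x * f x), integral_congr_ae (g := fun x => ‖f x‖)] at this
    · exact this
    · filter_upwards [hfm.coeFn_toLp] with x hx; rw [hx]
    · filter_upwards [hfm.coeFn_toLp] with x hx; rw [hx]

theorem linftyPairing_surjective [IsFiniteMeasure μ] :
    Function.Surjective (linftyPairing μ) := by
  intro φ
  have hone : MemLp (fun _ : α => (1 : ℂ)) 2 μ := memLp_const 1
  let J : Lp ℂ 2 μ →L[ℂ] Lp ℂ 1 μ :=
    (ContinuousLinearMap.mul ℂ ℂ).holderL μ 2 2 1 (hone.toLp _)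
  have hJ : ∀ f : Lp ℂ 2 μ, J f =ᵐ[μ] f := fun f => by
    filter_upwards [(ContinuousLinearMap.mul ℂ ℂ).coeFn_holder (r := 1) (hone.toLp _) f,
      hone.coeFn_toLp] with x h1 h2
    simp only [J, ContinuousLinearMap.holderL_apply_apply]
    rw [h1, h2]
    simp
  let k : Lp ℂ 2 μ := (InnerProductSpace.toDual ℂ (Lp ℂ 2 μ)).symm (φ ∘L J)
  have hk : ∀ f : Lp ℂ 2 μ, φ (J f) = ∫ x, (starRingEnd ℂ) (k x) * f x ∂μ := fun f => by
    have h1 : inner ℂ k f = (φ ∘L J) f := InnerProductSpace.toDual_symm_apply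
    rw [L2.inner_def] at h1
    rw [← ContinuousLinearMap.comp_apply, ← h1]
    congr 1
    funext x
    rw [RCLike.inner_apply']
  have hkm : StronglyMeasurable fun x => (starRingEnd ℂ) (k x) :=
    (Complex.continuous_conj.comp_stronglyMeasurable (Lp.stronglyMeasurable k))
  have hki : Integrable (fun x => (starRingEnd ℂ) (k x)) μ := by
    have h1 : Integrable k μ := (Lp.memLp k).integrable (by norm_num)
    exact h1.norm.mono' hkm.aestronglyMeasurable (.of_forall fun x => by simp)
  have hb : ∀ᵐ x ∂μ, ‖(starRingEnd ℂ) (k x)‖ ≤ ‖φ‖ := by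
    apply ae_norm_le_of_integral_le hkm hki
    intro f hf hf1
    have hf2 : MemLp f 2 μ := (memLp_top_of_bound hf.aestronglyMeasurable 1
      (.of_forall hf1)).mono_exponent le_top
    have h1 := φ.le_opNorm (J (hf2.toLp f))
    rw [hk, L1.norm_eq_integral_norm,
      integral_congr_ae (g := fun x => (starRingEnd ℂ) (k x) * f x),
      integral_congr_ae (g := fun x => ‖f x‖)] at h1
    · exact h1
    · filter_upwards [hJ (hf2.toLp f), hf2.coeFn_toLp] with x h2 h3; rw [h2, h3]
    · filter_upwards [hf2.coeFn_toLp] with x h3; rw [h3]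
  have hh : MemLp (fun x => (starRingEnd ℂ) (k x)) ∞ μ :=
    memLp_top_of_bound hkm.aestronglyMeasurable _ hb
  refine ⟨hh.toLp _, ?_⟩
  have hJd : ∀ f : Lp ℂ 2 μ, linftyPairing μ (hh.toLp _) (J f) = φ (J f) := fun f => by
    rw [linftyPairing_apply, hk]
    apply integral_congr_ae
    filter_upwards [hh.coeFn_toLp, hJ f] with x h1 h2
    rw [h1, h2]
  ext f
  induction f using Lp.induction (by norm_num : (1 : ℝ≥0∞) ≠ ∞) with
  | indicatorConst c hs hμs =>
    have h2 : (Lp.simpleFunc.indicatorConst 1 hs hμs.ne c : Lp ℂ 1 μ) =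
        J (indicatorConstLp 2 hs hμs.ne c) := by
      rw [Lp.simpleFunc.coe_indicatorConst]
      apply Lp.ext
      filter_upwards [hJ (indicatorConstLp 2 hs hμs.ne c),
        indicatorConstLp_coeFn (p := 2) (hs := hs) (hμs := hμs.ne) (c := c),
        indicatorConstLp_coeFn (p := 1) (hs := hs) (hμs := hμs.ne) (c := c)] with x h1 h2 h3
      rw [h1, h2, h3]
    rw [h2, hJd]
  | add hf hg _ h1 h2 => rw [map_add, map_add, h1, h2]
  | isClosed => exact isClosed_eq (ContinuousLinearMap.continuous _) φ.continuous

variable (μ)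

/-- The isometric isomorphism `L^∞(μ) ≃ L^1(μ)^*` for a finite measure `μ`. -/
def linftyDualEquiv [IsFiniteMeasure μ] : Lp ℂ ∞ μ ≃ₗᵢ[ℂ] StrongDual ℂ (Lp ℂ 1 μ) :=
  LinearIsometryEquiv.ofSurjective ⟨(linftyPairing μ).toLinearMap, linftyPairing_norm⟩
    linftyPairing_surjective

theorem linftyDualEquiv_apply [IsFiniteMeasure μ] (h : Lp ℂ ∞ μ) (f : Lp ℂ 1 μ) :
    linftyDualEquiv μ h f = ∫ x, h x * f x ∂μ :=
  linftyPairing_apply μ h f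

/-- The commutative W*-algebra `L^∞(μ)` of a finite measure `μ`, with pointwise almost everywhere
operations, the essential supremum norm and predual `L^1(μ)`. -/
def linfty [IsFiniteMeasure μ] : WStar where
  carrier := Lp ℂ ∞ μ
  predual := Lp ℂ 1 μ
  dualEquiv := linftyDualEquiv μ

theorem linfty_isCommutative [IsFiniteMeasure μ] : isCommutative (linfty μ) :=
  fun a b => LinftyAlg.mul_comm' a b

/-- The morphism `h ↦ h ∘ e` of `L^∞(μ)` for a measure preserving bijection `e`. -/
def linftyComp [IsFiniteMeasure μ] (e : α ≃ᵐ α) (he : MeasurePreserving e μ μ) :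
    linfty μ ⟶ linfty μ where
  toStarAlgHom :=
    ({ toFun := Lp.compMeasurePreserving e he
       map_one' := by
         apply Lp.ext
         filter_upwards [Lp.coeFn_compMeasurePreserving (1 : Lp ℂ ∞ μ) he,
           he.quasiMeasurePreserving.ae LinftyAlg.coeFn_one,
           LinftyAlg.coeFn_one (μ := μ)] with x h1 h2 h3
         rw [h1, Function.comp_apply, h2, h3]
       map_mul' := fun f g => by
         apply Lp.ext
         filter_upwards [Lp.coeFn_compMeasurePreserving (f * g) he,
           he.quasiMeasurePreserving.ae (LinftyAlg.coeFn_mul f g),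
           LinftyAlg.coeFn_mul (Lp.compMeasurePreserving e he f) (Lp.compMeasurePreserving e he g),
           Lp.coeFn_compMeasurePreserving f he,
           Lp.coeFn_compMeasurePreserving g he] with x h1 h2 h3 h4 h5
         rw [h1, Function.comp_apply, h2, h3, h4, h5, Function.comp_apply, Function.comp_apply]
       map_zero' := map_zero _
       map_add' := map_add _
       commutes' := fun c => by
         apply Lp.ext
         have e : algebraMap ℂ (Lp ℂ ∞ μ) c = c • (1 : Lp ℂ ∞ μ) :=
           Algebra.algebraMap_eq_smul_one c
         rw [e]
         filter_upwards [Lp.coeFn_compMeasurePreserving (c • (1 : Lp ℂ ∞ μ)) he,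
           he.quasiMeasurePreserving.ae (Lp.coeFn_smul c (1 : Lp ℂ ∞ μ)),
           he.quasiMeasurePreserving.ae LinftyAlg.coeFn_one,
           Lp.coeFn_smul c (1 : Lp ℂ ∞ μ),
           LinftyAlg.coeFn_one (μ := μ)] with x h1 h2 h3 h4 h5
         rw [h1, Function.comp_apply, h2, h4, Pi.smul_apply, Pi.smul_apply, h3, h5]
       map_star' := fun f => by
         apply Lp.ext
         filter_upwards [Lp.coeFn_compMeasurePreserving (star f) he,
           he.quasiMeasurePreserving.ae (Lp.coeFn_star f),
           Lp.coeFn_star (Lp.compMeasurePreserving e he f),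
           Lp.coeFn_compMeasurePreserving f he] with x h1 h2 h3 h4
         rw [h1, Function.comp_apply, h2, h3, Pi.star_apply, Pi.star_apply, h4,
           Function.comp_apply] } :
      Lp ℂ ∞ μ →⋆ₐ[ℂ] Lp ℂ ∞ μ)
  normal := by
    rw [normal_iff]
    intro (y : Lp ℂ 1 μ)
    have hes : MeasurePreserving e.symm μ μ := he.symm e
    let y' : Lp ℂ 1 μ := Lp.compMeasurePreserving e.symm hes y
    have key : ∀ h : Lp ℂ ∞ μ,
        linftyDualEquiv μ (Lp.compMeasurePreserving e he h) y = linftyDualEquiv μ h y' := by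
      intro h
      rw [linftyDualEquiv_apply, linftyDualEquiv_apply,
        ← he.integral_comp' (f := e) (fun x => h x * y' x)]
      apply integral_congr_ae
      filter_upwards [Lp.coeFn_compMeasurePreserving h he,
        he.quasiMeasurePreserving.ae (Lp.coeFn_compMeasurePreserving y hes)] with x h1 h2
      rw [h1, h2]
      simp
    have h2 := (linfty μ).continuous_eval y'
    have e2 : (fun h : Lp ℂ ∞ μ => linftyDualEquiv μ (Lp.compMeasurePreserving e he h) y) =
        fun h => linftyDualEquiv μ h y' := funext key
    exact e2 ▸ h2

end Linfty

/-! ### The circle -/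

instance instMeasurableSpaceCircle : MeasurableSpace Circle := borel Circle

instance instBorelSpaceCircle : BorelSpace Circle := ⟨rfl⟩

/-- Lebesgue (arc length) measure on the unit circle. -/
def circleMeasure : Measure Circle :=
  Measure.map Circle.exp (volume.restrict (Set.Ioc (-Real.pi) Real.pi))

instance instIsFiniteMeasureCircle : IsFiniteMeasure circleMeasure := by
  unfold circleMeasure
  infer_instance

theorem measurePreserving_circle_mul (w : Circle) :
    MeasurePreserving (fun z : Circle => w * z) circleMeasure circleMeasure := by
  have : Fact (0 < 2 * Real.pi) := ⟨Real.two_pi_pos⟩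
  have hcont : Continuous (AddCircle.toCircle (T := 2 * Real.pi)) := AddCircle.continuous_toCircle
  have hexp : ∀ x : ℝ, AddCircle.toCircle (x : AddCircle (2 * Real.pi)) = Circle.exp x := fun x => by
    rw [AddCircle.toCircle_apply_mk, div_self Real.two_pi_pos.ne', one_mul]
  have hmk := AddCircle.measurePreserving_mk (2 * Real.pi) (-Real.pi)
  have hmap : MeasurePreserving (AddCircle.toCircle (T := 2 * Real.pi)) volume circleMeasure := by
    refine ⟨hcont.measurable, ?_⟩
    rw [← hmk.map_eq, Measure.map_map hcont.measurable hmk.measurable, circleMeasure]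
    have e : -Real.pi + 2 * Real.pi = Real.pi := by ring
    rw [e]
    congr 1
    funext x
    exact hexp x
  refine ⟨(continuous_const.mul continuous_id).measurable, ?_⟩
  obtain ⟨θ, rfl⟩ := Circle.exp_surjective w
  have hadd : MeasurePreserving (fun x : AddCircle (2 * Real.pi) => (θ : AddCircle (2 * Real.pi)) + x)
      volume volume := measurePreserving_add_left volume _
  have h2 := hmap.comp hadd
  have h3 : (AddCircle.toCircle (T := 2 * Real.pi)) ∘
      (fun x : AddCircle (2 * Real.pi) => (θ : AddCircle (2 * Real.pi)) + x) =
      (fun z : Circle => Circle.exp θ * z) ∘ AddCircle.toCircle := by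
    funext x
    simp only [Function.comp_apply, AddCircle.toCircle_add, hexp]
  rw [h3] at h2
  have h4 := h2.map_eq
  have hmul : Measurable fun z : Circle => Circle.exp θ * z :=
    (continuous_const.mul continuous_id).measurable
  rwa [← Measure.map_map hmul hcont.measurable, hmap.map_eq] at h4

/-- Rotation `z ↦ w * z` of the circle as a measurable bijection. -/
def circleMul (w : Circle) : Circle ≃ᵐ Circle := (Homeomorph.mulLeft w).toMeasurableEquiv

/-- The W*-algebra `L^∞(𝕋, λ)`. -/
def linftyCircle : WStar := linfty circleMeasure

/-- Rotation by `w`: the morphism `f ↦ (z ↦ f (w⁻¹ z))` of `L^∞(𝕋, λ)`. -/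
def rotation (w : Circle) : linftyCircle ⟶ linftyCircle :=
  linftyComp circleMeasure (circleMul w⁻¹) (measurePreserving_circle_mul w⁻¹)

theorem rotation_apply (w : Circle) (f : Lp ℂ ∞ circleMeasure) :
    ⇑(show Lp ℂ ∞ circleMeasure from rotation w f) =ᵐ[circleMeasure] fun z => f (w⁻¹ * z) :=
  Lp.coeFn_compMeasurePreserving f (measurePreserving_circle_mul w⁻¹)

theorem unit_comp_rotation (w : Circle) :
    unit linftyCircle ≫ rotation w = unit linftyCircle ≫ 𝟙 linftyCircle := by
  rw [unit_comp, unit_comp]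

/-- The fork `ℂ ⟶ L^∞(𝕋, λ)` over rotation by `w` and the identity. -/
def rotationFork (w : Circle) : Fork (rotation w) (𝟙 linftyCircle) :=
  Fork.ofι (unit linftyCircle) (unit_comp_rotation w)

end WStar

/-! ### Commutative W*-algebras -/

/-- The full subcategory of commutative W*-algebras. -/
abbrev CommWStar := WStar.isCommutative.FullSubcategory

namespace CommWStar

/-- `ℂ` as a commutative W*-algebra. -/
def complex : CommWStar := ⟨WStar.complex, fun a b => mul_comm (G := ℂ) a b⟩

/-- `L^∞(𝕋, λ)` as a commutative W*-algebra. -/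
def linftyCircle : CommWStar := ⟨WStar.linftyCircle, WStar.linfty_isCommutative WStar.circleMeasure⟩

/-- The unital inclusion of `ℂ` into `L^∞(𝕋, λ)`. -/
def unit : complex ⟶ linftyCircle := ObjectProperty.homMk (WStar.unit WStar.linftyCircle)

/-- Rotation by `w` on `L^∞(𝕋, λ)`. -/
def rotation (w : Circle) : linftyCircle ⟶ linftyCircle :=
  ObjectProperty.homMk (WStar.rotation w)

theorem unit_comp_rotation (w : Circle) : unit ≫ rotation w = unit ≫ 𝟙 linftyCircle :=
  ObjectProperty.hom_ext _ (WStar.unit_comp_rotation w)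

/-- The fork `ℂ ⟶ L^∞(𝕋, λ)` over rotation by `w` and the identity, among commutative
W*-algebras. -/
def rotationFork (w : Circle) : Fork (rotation w) (𝟙 linftyCircle) :=
  Fork.ofι unit (unit_comp_rotation w)

/-- The restriction of the functor `- ⊗ N` to commutative W*-algebras, with values in commutative
W*-algebras. -/
def tensorRight {N : WStar} (T : ∀ M, WStar.CategoricalTensor M N)
    (hT : ∀ M, WStar.isCommutative M → WStar.isCommutative (T M).pt) : CommWStar ⥤ CommWStar :=
  WStar.isCommutative.lift (WStar.isCommutative.ι ⋙ WStar.tensorRight T)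
    fun M => hT M.obj M.property

end CommWStar

/-! ### Generalities on categories -/

/-- The image of a fork under a functor. -/
def mapFork {C D : Type*} [Category C] [Category D] (F : C ⥤ D) {X Y : C} {f g : X ⟶ Y}
    (c : Fork f g) : Fork (F.map f) (F.map g) :=
  Fork.ofι (F.map c.ι) (by rw [← F.map_comp, c.condition, F.map_comp])

/-- `Z` has a coexponential by `Y` (the dual of an exponential `Z ^ Y`): there is a universal
morphism from `Z` to an object of the form `E ⨿ Y`. -/
def HasCoexponential {C : Type*} [Category C] [HasBinaryCoproducts C] (Y Z : C) : Prop :=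
  ∃ (E : C) (e : Z ⟶ E ⨿ Y), ∀ (X : C) (f : Z ⟶ X ⨿ Y),
    ∃! g : E ⟶ X, e ≫ coprod.map g (𝟙 Y) = f

end

noncomputable section

namespace WStar

/-! ### The predual as a space of functionals -/

/-! An irrational rotation is ergodic, so its fixed functions are the constants, and a morphism with
scalar values factors normally through `ℂ`. This gives the equalizer in both categories.

The tensor product destroys it because the categorical tensor square of `L^∞(𝕋)` is much larger than
`L^∞(𝕋 × 𝕋)`: for every `u` in the circle it has a morphism `m_u : f ⊗ g ↦ ρ_u(f) g`, restriction to
the graph of a rotation, a null set of the torus. Let `K` be the common kernel of the `m_u` with `u`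
in the orbit of powers of `w`. Since `ρ_w ⊗ 1` permutes these morphisms, the `w*`-closed ideal `K`
is invariant, and so is its unit `e` (`exists_invariant_unit`). If `e` came from `ℂ ⊗ L^∞(𝕋)`, it
would be `1 ⊗ g`; then `g = m_1(e) = 0` and `K = 0`. But `K` is not zero
(`exists_mem_orbitKernel_ne_zero`): `m_u` maps `z ⊗ z̄` to the scalar `u⁻¹`, so a `w*`-limit of the
powers of `(1 - z ⊗ z̄)/2` is killed by `m_u` for `u ≠ -1` and sent to `1` for `u = -1`, and `-1` is
not a power of `w`. Right adjoints preserve limits, so there is no left adjoint; in the commutative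
case `- ⊗ Y` is `- ⨿ Y`, and having all coexponentials would supply one.

Existence of tensor products requires the basic theory of W*-algebras, developed here from the
predual alone. Balls are `w*`-compact, norms are lower semicontinuous, and from this follow
normality of the involution, `w*`-closedness of `[0, 1]`, suprema, range projections, norm density
of the span of the projections and finally normality of one-sided multiplications
(`comp_mulLeft_mem`). Hence `w*`-closures of `*`-subalgebras are W*-algebras.

Commuting pairs out of `M` and `N` form a proper class, but the functionals `(m, n) ↦ φ (f m * g n)`
that they induce form a set. Choosing one pair for each nonzero functional, taking the product and
passing to the generated W*-subalgebra gives a pair that represents them all. Any other pair then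
receives a morphism from it, the dual of a map of preduals (`exists_hom`). -/

/-- The embedding of the predual of `M` into the Banach dual of `M`. -/
def ev (M : WStar) : M.predual →ₗᵢ[ℂ] StrongDual ℂ M.carrier where
  toFun x := (NormedSpace.inclusionInDoubleDualLi ℂ x).comp
    (M.dualEquiv.toContinuousLinearEquiv : M.carrier →L[ℂ] StrongDual ℂ M.predual)
  map_add' x y := by ext m; simp
  map_smul' c x := by ext m; simp
  norm_map' x := by
    rw [← (NormedSpace.inclusionInDoubleDualLi (E := M.predual) ℂ).norm_map x]
    exact ContinuousLinearMap.opNorm_comp_linearIsometryEquiv _ M.dualEquiv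

theorem ev_apply (M : WStar) (x : M.predual) (m : M.carrier) : M.ev x m = M.dualEquiv m x := rfl

theorem ext_ev (M : WStar) {m m' : M.carrier} (h : ∀ x, M.ev x m = M.ev x m') : m = m' :=
  M.dualEquiv.injective (ContinuousLinearMap.ext h)

/-- The closed subspace of normal functionals on `M`. -/
def normalDual (M : WStar) : Submodule ℂ (StrongDual ℂ M.carrier) :=
  LinearMap.range M.ev.toLinearMap

theorem mem_normalDual {M : WStar} {F : StrongDual ℂ M.carrier} :
    F ∈ M.normalDual ↔ ∃ x, M.ev x = F := Iff.rfl

theorem ev_mem_normalDual (M : WStar) (x : M.predual) : M.ev x ∈ M.normalDual := ⟨x, rfl⟩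

theorem isClosed_normalDual (M : WStar) : IsClosed (M.normalDual : Set (StrongDual ℂ M.carrier)) :=
  M.ev.isometry.isClosedEmbedding.isClosed_range

theorem weakStarTopology_eq (M : WStar) :
    M.weakStarTopology = ⨅ x : M.predual, TopologicalSpace.induced (M.ev x) inferInstance := by
  unfold weakStarTopology
  have : (inferInstance : TopologicalSpace (WeakDual ℂ M.predual)) =
    TopologicalSpace.induced (fun f x => f x) Pi.topologicalSpace := rfl
  rw [this, induced_compose, ← induced_to_pi]
  rfl

/-- The `w*`-topology is initial for the functionals `M.ev x`, so its continuous linear functionals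
are their linear combinations, and the range of `M.ev` is already a subspace. -/
theorem continuous_iff_mem_normalDual (M : WStar) (F : StrongDual ℂ M.carrier) :
    Continuous[M.weakStarTopology, inferInstance] F ↔ F ∈ M.normalDual := by
  have h := LinearMap.mem_span_iff_continuous (f := fun x : M.predual => (M.ev x).toLinearMap)
    F.toLinearMap
  have e : M.weakStarTopology = ⨅ x : M.predual,
    TopologicalSpace.induced (M.ev x).toLinearMap inferInstance := M.weakStarTopology_eq
  rw [e]
  refine Iff.trans h.symm ?_
  have h2 : Set.range (fun x : M.predual => (M.ev x).toLinearMap) =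
      ((LinearMap.range ((ContinuousLinearMap.coeLM ℂ).comp M.ev.toLinearMap) :
        Submodule ℂ (M.carrier →ₗ[ℂ] ℂ)) : Set _) := rfl
  rw [h2, Submodule.span_eq, mem_normalDual, LinearMap.mem_range]
  exact exists_congr fun x =>
    ⟨fun hx => ContinuousLinearMap.coe_injective hx, fun hx => congrArg (fun G : StrongDual ℂ M.carrier => G.toLinearMap) hx⟩

/-- A morphism as a bounded linear map. -/
def Hom.toCLM {M N : WStar} (f : M ⟶ N) : M.carrier →L[ℂ] N.carrier :=
  LinearMap.mkContinuous (f.toStarAlgHom : M.carrier →ₗ[ℂ] N.carrier) 1 fun m => by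
    rw [one_mul]; exact NonUnitalStarAlgHom.norm_apply_le f.toStarAlgHom m

theorem Hom.comp_mem_normalDual {M N : WStar} (f : M ⟶ N) {F : StrongDual ℂ N.carrier}
    (hF : F ∈ N.normalDual) : F.comp f.toCLM ∈ M.normalDual := by
  rw [← continuous_iff_mem_normalDual] at hF ⊢
  exact @Continuous.comp _ _ _ M.weakStarTopology N.weakStarTopology _ _ _ hF f.normal

/-! ### Weak-star limits -/

/-- `u` converges to `m` along `l` in the `w*`-topology. -/
def WTendsto (M : WStar) {ι : Type*} (u : ι → M.carrier) (l : Filter ι) (m : M.carrier) : Prop :=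
  ∀ x, Filter.Tendsto (fun i => M.ev x (u i)) l (𝓝 (M.ev x m))

namespace WTendsto

variable {M N : WStar} {ι : Type*} {u v : ι → M.carrier} {l : Filter ι} {m n : M.carrier}

theorem unique [l.NeBot] (h : M.WTendsto u l m) (h' : M.WTendsto u l n) : m = n :=
  M.ext_ev fun x => tendsto_nhds_unique (h x) (h' x)

theorem add (h : M.WTendsto u l m) (h' : M.WTendsto v l n) :
    M.WTendsto (fun i => u i + v i) l (m + n) := fun x => by
  simpa using (h x).add (h' x)

theorem sub (h : M.WTendsto u l m) (h' : M.WTendsto v l n) :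
    M.WTendsto (fun i => u i - v i) l (m - n) := fun x => by
  simpa using (h x).sub (h' x)

theorem const (m : M.carrier) : M.WTendsto (fun _ : ι => m) l m := fun _ => tendsto_const_nhds

theorem smul (c : ℂ) (h : M.WTendsto u l m) : M.WTendsto (fun i => c • u i) l (c • m) := fun x => by
  simpa using (h x).const_mul c

theorem congr' (h : M.WTendsto u l m) (e : ∀ᶠ i in l, u i = v i) : M.WTendsto v l m := fun x =>
  (h x).congr' (e.mono fun i hi => by rw [hi])

theorem map (h : M.WTendsto u l m) (f : M ⟶ N) : N.WTendsto (fun i => f (u i)) l (f m) := fun y => by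
  obtain ⟨x, hx⟩ := f.comp_mem_normalDual (N.ev_mem_normalDual y)
  have e : ∀ a, N.ev y (f a) = M.ev x a := fun a => (DFunLike.congr_fun hx a).symm
  simp only [e]
  exact h x

/-- Lower semicontinuity of the norm. The arguments below turn algebraic facts into norm bounds in
order to pass them to `w*`-limits. -/
theorem norm_le [l.NeBot] (h : M.WTendsto u l m) {C : ℝ} (hC : 0 ≤ C)
    (hu : ∀ᶠ i in l, ‖u i‖ ≤ C) : ‖m‖ ≤ C := by
  rw [← M.dualEquiv.norm_map]
  refine ContinuousLinearMap.opNorm_le_bound _ hC fun x => ?_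
  refine le_of_tendsto (h x).norm (hu.mono fun i hi => ?_)
  calc ‖M.dualEquiv (u i) x‖ ≤ ‖M.dualEquiv (u i)‖ * ‖x‖ := ContinuousLinearMap.le_opNorm _ _
    _ ≤ C * ‖x‖ := by rw [M.dualEquiv.norm_map]; gcongr

end WTendsto

/-- Bounded families converge along ultrafilters. -/
theorem exists_wTendsto (M : WStar) {ι : Type*} (u : ι → M.carrier) (U : Ultrafilter ι) {C : ℝ}
    (hu : ∀ᶠ i in (U : Filter ι), ‖u i‖ ≤ C) : ∃ m, M.WTendsto u U m := by
  have hc := WeakDual.isCompact_closedBall (𝕜 := ℂ) (0 : StrongDual ℂ M.predual) C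
  have := hc.ultrafilter_le_nhds (U.map fun i => StrongDual.toWeakDual (M.dualEquiv (u i))) (by
    rw [Filter.le_principal_iff]
    refine hu.mono fun i hi => ?_
    simpa using hi)
  obtain ⟨f, -, hf⟩ := this
  refine ⟨M.dualEquiv.symm (WeakDual.toStrongDual f), fun x => ?_⟩
  have h2 := (WeakDual.eval_continuous x).tendsto f
  have h3 := h2.comp (Filter.tendsto_iff_comap.2 (Filter.map_le_iff_le_comap.1 hf))
  have e : M.ev x (M.dualEquiv.symm (WeakDual.toStrongDual f)) = f x := by
    rw [ev_apply, LinearIsometryEquiv.apply_symm_apply]; rfl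
  rw [e]
  exact h3

/-- A bounded functional which is `w*`-continuous at `0` on the unit ball is normal. -/
theorem mem_normalDual_of_ultrafilter (M : WStar) (F : StrongDual ℂ M.carrier)
    (h : ∀ (u : Finset M.predual → M.carrier) (U : Ultrafilter (Finset M.predual)),
      (∀ i, ‖u i‖ ≤ 1) → M.WTendsto u U 0 → Filter.Tendsto (fun i => F (u i)) U (𝓝 0)) :
    F ∈ M.normalDual := by
  classical
  have key : ∀ ε > 0, ∃ s : Finset M.predual, ∀ m : M.carrier, ‖m‖ ≤ 1 →
      (∀ x ∈ s, ‖M.ev x m‖ ≤ 1) → ‖F m‖ ≤ ε := by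
    intro ε hε
    by_contra! hcon
    -- One counterexample for each finite set of test functionals gives a net that tends to `0` in
    -- the `w*`-topology while `F` stays away from `0`.
    choose u hu1 hu2 hu3 using hcon
    let U : Ultrafilter (Finset M.predual) := Ultrafilter.of Filter.atTop
    have hU : (U : Filter (Finset M.predual)) ≤ Filter.atTop := Ultrafilter.of_le _
    have hw : M.WTendsto u U 0 := by
      intro x
      rw [map_zero]
      refine Filter.Tendsto.mono_left ?_ hU
      rw [Metric.tendsto_atTop]
      intro δ hδ
      -- Testing against `(2 / δ) x` bounds the value at `x` by `δ / 2`, hence strictly by `δ`.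
      refine ⟨{((2 / δ : ℝ) : ℂ) • x}, fun s hs => ?_⟩
      have h1 := hu2 s (((2 / δ : ℝ) : ℂ) • x) (by simpa using hs)
      rw [map_smul, _root_.smul_apply, norm_smul, Complex.norm_real,
        Real.norm_of_nonneg (by positivity), div_mul_eq_mul_div, div_le_one hδ] at h1
      rw [dist_zero_right]
      linarith
    have h1 := (h u U hu1 hw).norm
    rw [norm_zero] at h1
    have h2 : ∀ᶠ i in (U : Filter _), ‖F (u i)‖ < ε := h1.eventually (gt_mem_nhds hε)
    obtain ⟨i, hi⟩ := h2.exists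
    exact absurd hi (not_lt.2 (hu3 i).le)
  have hcl : F ∈ closure (M.normalDual : Set (StrongDual ℂ M.carrier)) := by
    rw [Metric.mem_closure_iff]
    intro ε hε
    obtain ⟨s, hs⟩ := key (ε / 2) (half_pos hε)
    -- On the common kernel `L` of the test functionals `F` has norm at most `ε / 2`. With `g` a
    -- Hahn–Banach extension of this restriction, `F - g` kills `L`, so it is a combination of
    -- finitely many `M.ev x`.
    let L : Submodule ℂ M.carrier := ⨅ x : s, LinearMap.ker (M.ev (x : M.predual)).toLinearMap
    have hL : ∀ m ∈ L, ∀ x ∈ s, M.ev x m = 0 := fun m hm x hx =>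
      (Submodule.mem_iInf _).1 hm ⟨x, hx⟩
    obtain ⟨g, hg1, hg2⟩ := exists_extension_norm_eq (𝕜 := ℂ) L (F.comp L.subtypeL)
    have hn : ‖g‖ ≤ ε / 2 := by
      rw [hg2]
      refine ContinuousLinearMap.opNorm_le_of_unit_norm (by positivity) ?_
      intro m hm
      exact hs m (by simpa using hm.le) fun x hx => by rw [hL m m.2 x hx]; simp
    have hspan : (F - g).toLinearMap ∈
        Submodule.span ℂ (Set.range fun x : s => (M.ev (x : M.predual)).toLinearMap) := by
      apply mem_span_of_iInf_ker_le_ker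
      intro m hm
      have := hg1 ⟨m, hm⟩
      simp only [ContinuousLinearMap.comp_apply, Submodule.subtypeL_apply] at this
      simp [this]
    obtain ⟨c, hc⟩ := (Submodule.mem_span_range_iff_exists_fun ℂ).1 hspan
    refine ⟨M.ev (∑ i, c i • (i : M.predual)), M.ev_mem_normalDual _, ?_⟩
    have e : F - M.ev (∑ i, c i • (i : M.predual)) = g := by
      ext m
      have := DFunLike.congr_fun hc m
      simp only [LinearMap.sum_apply, LinearMap.smul_apply, ContinuousLinearMap.coe_coe,
        _root_.sub_apply] at this
      simp only [map_sum, map_smul, _root_.sub_apply, _root_.sum_apply,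
        _root_.smul_apply]
      rw [this]; simp
    rw [dist_eq_norm, e]
    linarith
  rwa [M.isClosed_normalDual.closure_eq] at hcl

end WStar

/-! ### Order and norm in a C*-algebra -/

section CStar

variable {A : Type*} [CStarAlgebra A] [PartialOrder A] [StarOrderedRing A]

/-- The norm of a self-adjoint element is, up to sign, a point of its spectrum, and the two
inequalities confine the spectrum to `[-r, r]`. -/
theorem IsSelfAdjoint.norm_le_of_abs_le {a : A} (ha : IsSelfAdjoint a) {r : ℝ} (hr : 0 ≤ r)
    (h1 : a ≤ algebraMap ℝ A r) (h2 : -a ≤ algebraMap ℝ A r) : ‖a‖ ≤ r := by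
  rcases subsingleton_or_nontrivial A with _ | _
  · rw [Subsingleton.elim a 0, norm_zero]; exact hr
  have h1' : ∀ x ∈ spectrum ℝ a, x ≤ r := (le_algebraMap_iff_spectrum_le ha).1 h1
  have h2' : ∀ x ∈ spectrum ℝ a, -r ≤ x := by
    have : algebraMap ℝ A (-r) ≤ a := by
      rw [map_neg]; exact neg_le.1 h2
    exact (algebraMap_le_iff_le_spectrum ha).1 this
  rcases CStarAlgebra.norm_or_neg_norm_mem_spectrum (a := a) ha with h | h
  · exact h1' _ h
  · have := h2' _ h; linarith

/-- Positivity from a norm bound, a condition that survives `w*`-limits. -/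
theorem CStarAlgebra.nonneg_of_norm_one_sub_le {a : A} (ha : IsSelfAdjoint a) (h : ‖1 - a‖ ≤ 1) :
    0 ≤ a := by
  have h1 : (1 - a) ≤ algebraMap ℝ A ‖1 - a‖ :=
    IsSelfAdjoint.le_algebraMap_norm_self ((IsSelfAdjoint.one A).sub ha)
  have h2 : algebraMap ℝ A ‖1 - a‖ ≤ algebraMap ℝ A 1 := algebraMap_mono A h
  have h3 := h1.trans h2
  rw [map_one] at h3
  simpa using h3

end CStar

/-! ### Self-adjointness and positivity of `w*`-limits -/

namespace WStar

instance instPartialOrderCarrier (M : WStar) : PartialOrder M.carrier :=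
  CStarAlgebra.spectralOrder M.carrier

instance instStarOrderedRingCarrier (M : WStar) : StarOrderedRing M.carrier :=
  CStarAlgebra.spectralOrderedRing M.carrier

variable {M : WStar} {ι : Type*} {u : ι → M.carrier} {U : Ultrafilter ι} {m : M.carrier}

theorem norm_one_le (M : WStar) : ‖(1 : M.carrier)‖ ≤ 1 := by
  rcases subsingleton_or_nontrivial M.carrier with _ | _
  · rw [Subsingleton.elim (1 : M.carrier) 0, norm_zero]; exact zero_le_one
  · rw [norm_one]

/-- The self-adjoint part of the unit ball is `w*`-closed. -/
theorem WTendsto.isSelfAdjoint (h : M.WTendsto u U m) (hu : ∀ i, ‖u i‖ ≤ 1)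
    (hsa : ∀ i, IsSelfAdjoint (u i)) : IsSelfAdjoint m := by
  -- This is twice the imaginary part of `m`.
  set c : M.carrier := Complex.I • (star m - m) with hc
  have hcsa : IsSelfAdjoint c := by
    rw [IsSelfAdjoint, hc, star_smul, star_sub, star_star]
    simp only [Complex.star_def, Complex.conj_I, neg_smul, ← smul_neg]
    congr 1; abel
  -- For self-adjoint contractions `‖u i + it‖² ≤ 1 + t²`, and the bound passes to `m`. Expanding
  -- `(m + it)* (m + it) = m* m + t c + t²` leaves `t c ≤ 1`, for `t` of either sign and any size,
  -- so `c = 0`.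
  have key : ∀ t : ℝ, t • c ≤ 1 := by
    intro t
    have hn : ‖m + (Complex.I * t) • (1 : M.carrier)‖ ≤ Real.sqrt (1 + t ^ 2) := by
      refine WTendsto.norm_le (u := fun i => u i + (Complex.I * t) • (1 : M.carrier))
        (h.add (WTendsto.const _)) (Real.sqrt_nonneg _) (.of_forall fun i => ?_)
      apply Real.le_sqrt_of_sq_le
      rw [sq, ← CStarRing.norm_star_mul_self]
      have e : star (u i + (Complex.I * t) • (1 : M.carrier)) * (u i + (Complex.I * t) • 1) =
          u i * u i + ((t ^ 2 : ℝ) : ℂ) • 1 := by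
        simp only [star_add, star_smul, (hsa i).star_eq, star_one, add_mul, mul_add, smul_mul_assoc,
          mul_smul_comm, one_mul, mul_one, smul_add, smul_smul, Complex.star_def, map_mul, Complex.conj_I,
          Complex.conj_ofReal]
        rw [show Complex.I * t * (-Complex.I * t) = ((t ^ 2 : ℝ) : ℂ) by
          push_cast; linear_combination (-(t : ℂ) ^ 2) * Complex.I_sq]
        module
      rw [e]
      calc _ ≤ ‖u i‖ * ‖u i‖ + t ^ 2 * 1 := by
            refine (norm_add_le _ _).trans (add_le_add (norm_mul_le _ _) ?_)
            rw [norm_smul, Complex.norm_real, Real.norm_of_nonneg (sq_nonneg t)]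
            exact mul_le_mul_of_nonneg_left M.norm_one_le (sq_nonneg t)
        _ ≤ 1 + t ^ 2 := by nlinarith [hu i, norm_nonneg (u i)]
    have h1 := CStarAlgebra.star_mul_le_algebraMap_norm_sq
      (a := m + (Complex.I * t) • (1 : M.carrier))
    have h2 : ‖m + (Complex.I * t) • (1 : M.carrier)‖ ^ 2 ≤ 1 + t ^ 2 :=
      (pow_le_pow_left₀ (norm_nonneg _) hn 2).trans (Real.sq_sqrt (by positivity)).le
    have h3 := h1.trans (algebraMap_mono M.carrier h2)
    have e : star (m + (Complex.I * t) • (1 : M.carrier)) * (m + (Complex.I * t) • 1) =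
        star m * m + t • c + algebraMap ℝ M.carrier (t ^ 2) := by
      have e1 : t • c = (t : ℂ) • c := rfl
      have e2 : algebraMap ℝ M.carrier (t ^ 2) = ((t ^ 2 : ℝ) : ℂ) • (1 : M.carrier) := by
        rw [Algebra.algebraMap_eq_smul_one]; rfl
      rw [e1, e2, hc]
      simp only [star_add, star_smul, star_one, add_mul, mul_add, smul_mul_assoc,
        mul_smul_comm, one_mul, mul_one, smul_add, smul_smul, Complex.star_def, map_mul, Complex.conj_I,
        Complex.conj_ofReal]
      rw [show Complex.I * t * (-Complex.I * t) = ((t ^ 2 : ℝ) : ℂ) by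
          push_cast; linear_combination (-(t : ℂ) ^ 2) * Complex.I_sq]
      module
    rw [e, map_add, map_one, add_le_add_iff_right] at h3
    exact (le_add_of_nonneg_left (star_mul_self_nonneg m)).trans h3
  have hc0 : c = 0 := by
    rw [← norm_le_zero_iff]
    refine le_of_forall_pos_le_add fun ε hε => ?_
    rw [zero_add]
    have hh : ‖ε⁻¹ • c‖ ≤ 1 := by
      apply IsSelfAdjoint.norm_le_of_abs_le ((IsSelfAdjoint.all ε⁻¹).smul hcsa) zero_le_one
      · rw [map_one]; exact key _
      · rw [map_one, ← neg_smul]; exact key _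
    rw [norm_smul, Real.norm_of_nonneg (by positivity), inv_mul_le_iff₀ hε, mul_one] at hh
    exact hh
  have := (smul_eq_zero_iff_right Complex.I_ne_zero).1 hc0
  exact sub_eq_zero.1 this

/-- The order interval `[0, 1]` is `w*`-closed. -/
theorem WTendsto.nonneg (h : M.WTendsto u U m) (hu : ∀ᶠ i in (U : Filter ι), 0 ≤ u i ∧ u i ≤ 1) :
    0 ≤ m := by
  classical
  -- The bounds hold only eventually; replacing the other terms by `0` makes them hold everywhere
  -- without changing the limit.
  set v : ι → M.carrier := fun i => if 0 ≤ u i ∧ u i ≤ 1 then u i else 0 with hv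
  have hv2 : ∀ i, 0 ≤ v i ∧ v i ≤ 1 := fun i => by
    simp only [hv]; split_ifs with h0
    · exact h0
    · exact ⟨le_rfl, zero_le_one⟩
  have h' : M.WTendsto v U m := h.congr' (hu.mono fun i hi => by simp only [hv, if_pos hi])
  have hn : ∀ a : M.carrier, 0 ≤ a → a ≤ 1 → ‖a‖ ≤ 1 := fun a h0 h1 =>
    (CStarAlgebra.norm_le_one_iff_of_nonneg a h0).2 h1
  have hsa := h'.isSelfAdjoint (fun i => hn _ (hv2 i).1 (hv2 i).2)
    fun i => IsSelfAdjoint.of_nonneg (hv2 i).1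
  refine CStarAlgebra.nonneg_of_norm_one_sub_le hsa ?_
  refine ((WTendsto.const 1).sub h').norm_le zero_le_one (.of_forall fun i => ?_)
  exact hn _ (sub_nonneg.2 (hv2 i).2) (sub_le_self _ (hv2 i).1)

/-! ### Normality of the involution -/

/-- The adjoint of a functional. -/
def adjointFunctional (M : WStar) (F : StrongDual ℂ M.carrier) : StrongDual ℂ M.carrier :=
  LinearMap.mkContinuous
    { toFun := fun m => star (F (star m))
      map_add' := fun a b => by simp
      map_smul' := fun c a => by simp [star_smul] } ‖F‖ fun m => by
    simpa using F.le_opNorm (star m)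

@[simp]
theorem adjointFunctional_apply (F : StrongDual ℂ M.carrier) (m : M.carrier) :
    M.adjointFunctional F m = star (F (star m)) := rfl

/-- If `u` tends to `0`, its real and imaginary parts have self-adjoint limits `a` and `b` along the
ultrafilter, with `a + ib = 0`. Taking adjoints, `a - ib = 0`, and this is the limit of `star u`. -/
theorem adjointFunctional_mem {F : StrongDual ℂ M.carrier} (hF : F ∈ M.normalDual) :
    M.adjointFunctional F ∈ M.normalDual := by
  obtain ⟨x, rfl⟩ := hF
  apply mem_normalDual_of_ultrafilter
  intro u U hu hw
  have hre : ∀ i, ‖(realPart (u i) : M.carrier)‖ ≤ 1 := fun i =>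
    (realPart.norm_le (u i)).trans (hu i)
  have him : ∀ i, ‖(imaginaryPart (u i) : M.carrier)‖ ≤ 1 := fun i =>
    (imaginaryPart.norm_le (u i)).trans (hu i)
  obtain ⟨a, ha⟩ := M.exists_wTendsto (fun i => (realPart (u i) : M.carrier)) U (.of_forall hre)
  obtain ⟨b, hb⟩ := M.exists_wTendsto (fun i => (imaginaryPart (u i) : M.carrier)) U
    (.of_forall him)
  have hasa := ha.isSelfAdjoint hre fun i => (realPart (u i)).2
  have hbsa := hb.isSelfAdjoint him fun i => (imaginaryPart (u i)).2
  have h0 : a + Complex.I • b = 0 := by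
    refine ((ha.add (hb.smul Complex.I)).congr' (.of_forall fun i => ?_)).unique hw
    exact realPart_add_I_smul_imaginaryPart (u i)
  have h1 : a - Complex.I • b = 0 := by
    have := congrArg star h0
    simpa [star_smul, hasa.star_eq, hbsa.star_eq, sub_eq_add_neg] using this
  have h2 : M.WTendsto (fun i => star (u i)) U 0 := by
    rw [← h1]
    refine (ha.sub (hb.smul Complex.I)).congr' (.of_forall fun i => ?_)
    conv_rhs => rw [← realPart_add_I_smul_imaginaryPart (u i)]
    simp [star_smul, sub_eq_add_neg, (realPart (u i)).2.star_eq, (imaginaryPart (u i)).2.star_eq]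
  have h3 := (h2 x).star
  simpa using h3

/-! ### Suprema and range projections -/

/-- A limit along a nonprincipal ultrafilter is the supremum, because order relations pass to
limits. Competing upper bounds are taken below `1` so that all differences stay in `[0, 1]`. -/
theorem exists_sup (M : WStar) (f : ℕ → M.carrier) (hf0 : ∀ n, 0 ≤ f n) (hf1 : ∀ n, f n ≤ 1)
    (hmono : Monotone f) : ∃ p, p ≤ 1 ∧ (∀ n, f n ≤ p) ∧
      ∀ q, q ≤ 1 → (∀ n, f n ≤ q) → p ≤ q := by
  let U : Ultrafilter ℕ := Filter.hyperfilter ℕ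
  obtain ⟨p, hp⟩ := M.exists_wTendsto f U (.of_forall fun n =>
    (CStarAlgebra.norm_le_one_iff_of_nonneg _ (hf0 n)).2 (hf1 n))
  refine ⟨p, ?_, fun n => ?_, fun q hq1 hq => ?_⟩
  · rw [← sub_nonneg]
    exact ((WTendsto.const 1).sub hp).nonneg
      (.of_forall fun n => ⟨sub_nonneg.2 (hf1 n), sub_le_self _ (hf0 n)⟩)
  · rw [← sub_nonneg]
    refine (hp.sub (WTendsto.const (f n))).nonneg ?_
    have : ∀ᶠ k in (U : Filter ℕ), n ≤ k :=
      (Nat.hyperfilter_le_atTop) (Filter.eventually_ge_atTop n)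
    filter_upwards [this] with k hk
    exact ⟨sub_nonneg.2 (hmono hk), (sub_le_self _ (hf0 n)).trans (hf1 k)⟩
  · rw [← sub_nonneg]
    exact ((WTendsto.const q).sub hp).nonneg
      (.of_forall fun n => ⟨sub_nonneg.2 (hq n), (sub_le_self _ (hf0 n)).trans hq1⟩)

/-- A contraction `x ≥ 0` has a range projection: it lies above `x` and below every `y` in `[0, 1]`
with `x y = x`. -/
theorem exists_range_projection (M : WStar) {x : M.carrier} (hx0 : 0 ≤ x) (hx1 : x ≤ 1) :
    ∃ p : M.carrier, IsStarProjection p ∧ x ≤ p ∧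
      ∀ y, 0 ≤ y → y ≤ 1 → x * y = x → p ≤ y := by
  -- The roots `x ^ (1 / 2ⁿ)` increase, and their supremum is the range projection.
  let f : ℕ → M.carrier := fun n => (CFC.sqrt)^[n] x
  have hfs : ∀ n, f (n + 1) = CFC.sqrt (f n) := fun n => Function.iterate_succ_apply' _ _ _
  have hf0 : ∀ n, 0 ≤ f n := fun n => by
    cases n with
    | zero => exact hx0
    | succ n => rw [hfs]; exact CFC.sqrt_nonneg _
  have hsq : ∀ n, f (n + 1) * f (n + 1) = f n := fun n => by
    rw [hfs]; exact CFC.sqrt_mul_sqrt_self _ (hf0 n)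
  have hf1 : ∀ n, f n ≤ 1 := fun n => by
    induction n with
    | zero => exact hx1
    | succ n ih =>
      rw [← CStarAlgebra.norm_le_one_iff_of_nonneg _ (hf0 _)] at ih ⊢
      rw [← hsq n, (IsSelfAdjoint.of_nonneg (hf0 (n + 1))).norm_mul_self] at ih
      nlinarith [norm_nonneg (f (n + 1))]
  have hcomm : ∀ n k, Commute (f n) (f k) := by
    have h1 : ∀ a : M.carrier, Commute x a → ∀ n, Commute (f n) a := fun a ha n => by
      induction n with
      | zero => exact ha
      | succ n ih => rw [hfs, CFC.sqrt_eq_cfc]; exact ih.cfc_nnreal _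
    intro n k
    exact h1 _ (h1 x (Commute.refl x) k).symm n
  have hle : ∀ {a b : M.carrier}, 0 ≤ a → b ≤ 1 → Commute a b → a * b ≤ a := by
    intro a b ha hb hab
    have := Commute.mul_nonneg ha (sub_nonneg.2 hb) ((Commute.one_right a).sub_right hab)
    rw [mul_sub, mul_one] at this
    exact sub_nonneg.1 this
  have hmono : Monotone f := monotone_nat_of_le_succ fun n => by
    rw [← hsq n]
    exact hle (hf0 _) (hf1 _) (Commute.refl _)
  obtain ⟨p, hp1, hfp, hpq⟩ := M.exists_sup f hf0 hf1 hmono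
  have hp0 : 0 ≤ p := hx0.trans (hfp 0)
  have hpsa : IsSelfAdjoint p := IsSelfAdjoint.of_nonneg hp0
  -- Multiplication is not yet known to be normal, so that `p` commutes with the `f n` is derived
  -- from order: a unitary `v` commuting with all `f n` conjugates `p` to another upper bound.
  -- Applied to `v` and `star v` this gives `v p v* = p`. The unitaries of the C*-algebra generated
  -- by `f n` span it.
  have hconj : ∀ v : M.carrier, v ∈ unitary M.carrier → (∀ n, Commute v (f n)) →
      p ≤ v * p * star v := by
    intro v hv hvf
    apply hpq
    · have := star_right_conjugate_le_conjugate hp1 v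
      rwa [mul_one, Unitary.mul_star_self_of_mem hv] at this
    · intro n
      have := star_right_conjugate_le_conjugate (hfp n) v
      rwa [(hvf n).eq, mul_assoc, Unitary.mul_star_self_of_mem hv, mul_one] at this
  have hcommv : ∀ v : M.carrier, v ∈ unitary M.carrier → (∀ n, Commute v (f n)) →
      Commute v p := by
    intro v hv hvf
    have h1 := hconj v hv hvf
    have h2 := hconj (star v) (Unitary.star_mem hv) fun n => by
      have := (hvf n).star_star
      rwa [(IsSelfAdjoint.of_nonneg (hf0 n)).star_eq] at this
    have h3 := star_right_conjugate_le_conjugate h2 v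
    have h4 : v * (star v * p * star (star v)) * star v = p := by
      rw [star_star]
      calc _ = (v * star v) * p * (v * star v) := by noncomm_ring
        _ = p := by rw [Unitary.mul_star_self_of_mem hv]; simp
    rw [h4] at h3
    have h5 := le_antisymm h1 h3
    calc v * p = v * p * (star v * v) := by rw [Unitary.star_mul_self_of_mem hv, mul_one]
      _ = (v * p * star v) * v := by noncomm_ring
      _ = p * v := by rw [← h5]
  have hpf : ∀ n, Commute (f n) p := by
    intro n
    let E := StarAlgebra.elemental ℂ (f n)
    have hE : ∀ v ∈ E, ∀ k, Commute v (f k) := by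
      intro v hv k
      refine (StarAlgebra.elemental.le_centralizer_centralizer ℂ (f n) hv (f k) (Or.inl ?_)).symm
      rintro a (ha | ha)
      · rw [Set.mem_singleton_iff.1 ha]; exact hcomm n k
      · rw [Set.mem_star, Set.mem_singleton_iff] at ha
        rw [← star_star a, ha, (IsSelfAdjoint.of_nonneg (hf0 n)).star_eq]; exact hcomm n k
    have hspan : ∀ v : E, Commute (v : M.carrier) p := by
      intro v
      have hv : v ∈ Submodule.span ℂ (unitary E : Set E) := by
        rw [CStarAlgebra.span_unitary]; trivial
      induction hv using Submodule.span_induction with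
      | mem v hv =>
        refine hcommv v ?_ (hE v v.2)
        rw [Unitary.mem_iff]
        exact ⟨congrArg Subtype.val (Unitary.star_mul_self_of_mem hv),
          congrArg Subtype.val (Unitary.mul_star_self_of_mem hv)⟩
      | zero => exact Commute.zero_left _
      | add a b _ _ ha hb => exact Commute.add_left ha hb
      | smul c a _ ha => exact Commute.smul_left ha c
    exact hspan ⟨f n, StarAlgebra.elemental.self_mem ℂ (f n)⟩
  have hpp1 : p * p ≤ p := hle hp0 hp1 (Commute.refl p)
  -- Commutation gives `f n = f (n + 1)² ≤ f (n + 1) p ≤ p²`, so `p²` is an upper bound.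
  have hpp2 : p ≤ p * p := by
    apply hpq _ (hpp1.trans hp1)
    intro n
    have h1 := Commute.mul_nonneg (hf0 (n + 1)) (sub_nonneg.2 (hfp (n + 1)))
      ((hpf (n + 1)).sub_right (Commute.refl _))
    have h2 := Commute.mul_nonneg hp0 (sub_nonneg.2 (hfp (n + 1)))
      ((Commute.refl p).sub_right (hpf (n + 1)).symm)
    rw [mul_sub, sub_nonneg] at h1 h2
    rw [← hsq n]
    exact h1.trans ((hpf (n + 1)).eq.le.trans h2)
  refine ⟨p, ⟨le_antisymm hpp1 hpp2, hpsa⟩, hfp 0, fun y hy0 hy1 hxy => hpq y hy1 fun n => ?_⟩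
  have hysa : IsSelfAdjoint y := IsSelfAdjoint.of_nonneg hy0
  -- Annihilation passes to square roots by the C*-identity, since `f (n + 1)² = f n`. Then `f n = y
  -- * f n ≤ y`.
  have hfy : ∀ n, f n * (1 - y) = 0 := by
    intro n
    induction n with
    | zero => change x * (1 - y) = 0; rw [mul_sub, mul_one, hxy, sub_self]
    | succ n ih =>
      rw [← CStarRing.star_mul_self_eq_zero_iff, star_mul,
        (IsSelfAdjoint.of_nonneg (hf0 (n + 1))).star_eq, mul_assoc, ← mul_assoc (f (n + 1)), hsq, ih,
        mul_zero]
  have e1 : f n * y = f n := by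
    have := hfy n
    rw [mul_sub, mul_one, sub_eq_zero] at this
    exact this.symm
  have e2 : y * f n = f n := by
    have := congrArg star e1
    rwa [star_mul, hysa.star_eq, (IsSelfAdjoint.of_nonneg (hf0 n)).star_eq] at this
  have := Commute.mul_nonneg hy0 (sub_nonneg.2 (hf1 n))
    ((Commute.one_right y).sub_right (e2.trans e1.symm))
  rw [mul_sub, mul_one, e2] at this
  exact sub_nonneg.1 this

end WStar

namespace WStar

variable {M : WStar} {ι : Type*} {u : ι → M.carrier} {U : Ultrafilter ι} {m : M.carrier}

/-! ### Density of the span of the projections -/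

/-- The truncation of `t - k` to `[0, 1]`. -/
def clampStep (k : ℕ) (t : ℝ) : ℝ := max 0 (min 1 (t - k))

theorem continuous_clampStep (k : ℕ) : Continuous (clampStep k) := by
  unfold clampStep; fun_prop

theorem sum_clampStep (n : ℕ) {t : ℝ} (ht : 0 ≤ t) :
    ∑ k ∈ Finset.range n, clampStep k t = min (n : ℝ) t := by
  induction n with
  | zero => simp [ht]
  | succ n ih =>
    rw [Finset.sum_range_succ, ih, clampStep]
    push_cast
    rcases le_total t n with h | h
    · rw [min_eq_right h, min_eq_right (by linarith : t - n ≤ 1), max_eq_left (by linarith),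
        min_eq_right (by linarith)]; ring
    · rw [min_eq_left h]
      rcases le_total t (n + 1) with h2 | h2
      · rw [min_eq_right (by linarith : t - n ≤ 1), max_eq_right (by linarith), min_eq_right h2]
        ring
      · rw [min_eq_left (by linarith : 1 ≤ t - n), max_eq_right zero_le_one, min_eq_left h2]

/-- Each layer is saturated at `1` wherever the next one is nonzero; this leaves room for a
projection between them. -/
theorem clampStep_mul (k : ℕ) (t : ℝ) : clampStep (k + 1) t * clampStep k t = clampStep (k + 1) t := by
  unfold clampStep
  push_cast
  rcases le_total t (k + 1) with h | h
  · rw [max_eq_left (a := (0 : ℝ)) (b := min 1 (t - (k + 1))) ((min_le_right _ _).trans (by linarith)),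
      zero_mul]
  · rw [min_eq_left (by linarith : 1 ≤ t - k), max_eq_right zero_le_one, mul_one]

/-- Cut `N a` into layers `x k` with sum `N a`. As `x (k + 1) * x k = x (k + 1)`, the range
projection `p k` of `x (k + 1)` lies between `x (k + 1)` and `x k`, so the sum of the `x k - p k` is
at most the telescoping sum `x 0 - x N ≤ 1`. The error does not depend on `N`, so dividing by `N`
gives density. -/
theorem exists_span_projection_near (M : WStar) {a : M.carrier} (ha0 : 0 ≤ a) (ha1 : a ≤ 1) (N : ℕ) :
    ∃ s ∈ Submodule.span ℂ {p : M.carrier | IsStarProjection p}, ‖(N : ℂ) • a - s‖ ≤ 1 := by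
  have hasa : IsSelfAdjoint a := IsSelfAdjoint.of_nonneg ha0
  let c : ℕ → ℝ → ℝ := fun k t => clampStep k (N * t)
  have hc : ∀ k, Continuous (c k) := fun k => (continuous_clampStep k).comp (by fun_prop)
  let x : ℕ → M.carrier := fun k => cfc (c k) a
  have hx0 : ∀ k, 0 ≤ x k := fun k => cfc_nonneg fun t _ => le_max_left _ _
  have hx1 : ∀ k, x k ≤ 1 := fun k => by
    refine cfc_le_one (c k) a fun t _ => max_le zero_le_one (min_le_left _ _)
  have hxx : ∀ k, x (k + 1) * x k = x (k + 1) := fun k => by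
    simp only [x]
    rw [← cfc_mul (c (k + 1)) (c k) a (hc _).continuousOn (hc _).continuousOn]
    congr 1
    funext t
    exact clampStep_mul k _
  have hsum : ∑ k ∈ Finset.range N, x k = (N : ℂ) • a := by
    simp only [x]
    rw [← cfc_sum c a (Finset.range N) fun i _ => (hc i).continuousOn]
    have e : (N : ℂ) • a = cfc (fun t : ℝ => (N : ℝ) • t) a := by
      rw [cfc_smul (R := ℝ) (N : ℝ) (fun t => t) a, cfc_id' ℝ a]
      norm_cast
    rw [e]
    refine cfc_congr fun t ht => ?_
    have h0 : 0 ≤ t := spectrum_nonneg_of_nonneg ha0 ht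
    have h1 : t ≤ 1 := by
      rw [← map_one (algebraMap ℝ M.carrier)] at ha1
      exact (le_algebraMap_iff_spectrum_le hasa).1 ha1 t ht
    simp only [c, Finset.sum_apply, smul_eq_mul]
    rw [sum_clampStep N (by positivity), min_eq_right]
    exact mul_le_of_le_one_right (Nat.cast_nonneg _) h1
  choose p hp hxp hpx using fun k => M.exists_range_projection (hx0 (k + 1)) (hx1 (k + 1))
  refine ⟨∑ k ∈ Finset.range N, p k, Submodule.sum_mem _ fun k _ => Submodule.subset_span (hp k), ?_⟩
  rw [← hsum, ← Finset.sum_sub_distrib]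
  have h0 : 0 ≤ ∑ k ∈ Finset.range N, (x k - p k) := Finset.sum_nonneg fun k _ =>
    sub_nonneg.2 (hpx k (x k) (hx0 k) (hx1 k) (hxx k))
  rw [CStarAlgebra.norm_le_one_iff_of_nonneg _ h0]
  calc ∑ k ∈ Finset.range N, (x k - p k) ≤ ∑ k ∈ Finset.range N, (x k - x (k + 1)) :=
        Finset.sum_le_sum fun k _ => sub_le_sub_left (hxp k) _
    _ = x 0 - x N := Finset.sum_range_sub' _ _
    _ ≤ x 0 := sub_le_self _ (hx0 N)
    _ ≤ 1 := hx1 0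

theorem span_projection_dense (M : WStar) :
    (Submodule.span ℂ {p : M.carrier | IsStarProjection p}).topologicalClosure = ⊤ := by
  set W := Submodule.span ℂ {p : M.carrier | IsStarProjection p} with hW
  have h01 : ∀ a : M.carrier, 0 ≤ a → a ≤ 1 → a ∈ W.topologicalClosure := by
    intro a ha0 ha1
    refine Metric.mem_closure_iff.2 fun ε hε => ?_
    obtain ⟨N, hN⟩ := exists_nat_gt ε⁻¹
    have hNpos : (0 : ℝ) < N := (inv_pos.2 hε).trans hN
    obtain ⟨s, hs, hsn⟩ := M.exists_span_projection_near ha0 ha1 N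
    refine ⟨(N : ℂ)⁻¹ • s, W.smul_mem _ hs, ?_⟩
    have hNc : (N : ℂ) ≠ 0 := by exact_mod_cast hNpos.ne'
    have e : a - (N : ℂ)⁻¹ • s = (N : ℂ)⁻¹ • ((N : ℂ) • a - s) := by
      rw [smul_sub, smul_smul, inv_mul_cancel₀ hNc, one_smul]
    rw [dist_eq_norm, e, norm_smul, norm_inv, Complex.norm_natCast]
    calc (N : ℝ)⁻¹ * _ ≤ (N : ℝ)⁻¹ * 1 := by gcongr
      _ < ε := by rw [mul_one]; exact inv_lt_of_inv_lt₀ hε hN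
  rw [eq_top_iff, ← CStarAlgebra.span_nonneg, Submodule.span_le]
  intro a (ha : 0 ≤ a)
  by_cases h : ‖a‖ = 0
  · rw [norm_eq_zero.1 h]; exact Submodule.zero_mem _
  have hpos : 0 < ‖a‖ := lt_of_le_of_ne (norm_nonneg _) (Ne.symm h)
  have h1 : (‖a‖⁻¹ : ℝ) • a ∈ W.topologicalClosure := by
    have h0 : 0 ≤ (‖a‖⁻¹ : ℝ) • a := smul_nonneg (by positivity) ha
    refine h01 _ h0 ?_
    rw [← CStarAlgebra.norm_le_one_iff_of_nonneg _ h0, norm_smul, norm_inv, norm_norm,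
      inv_mul_cancel₀ h]
  have h2 := W.topologicalClosure.smul_mem ((‖a‖ : ℝ) : ℂ) h1
  have e : ((‖a‖ : ℝ) : ℂ) • ((‖a‖⁻¹ : ℝ) • a) = a := by
    change (‖a‖ : ℝ) • ((‖a‖⁻¹ : ℝ) • a) = a
    rw [smul_smul, mul_inv_cancel₀ h, one_smul]
  rwa [e] at h2

/-! ### Separate normality of the multiplication -/

/-- Let `w = (1 - p) m`. Since `u i` lies in `p M`, orthogonality gives `‖u i + n w‖² ≤ 1 + n²
‖w‖²`, which passes to `m`. But `(1 - p)(m + n w) = (1 + n) w`, so `(1 + n)² ‖w‖² ≤ 1 + n² ‖w‖²` for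
all `n`, and `w = 0`. -/
theorem WTendsto.projection_mul {p : M.carrier} (hp : IsStarProjection p) (h : M.WTendsto u U m)
    (hu : ∀ i, ‖u i‖ ≤ 1) (hpu : ∀ i, p * u i = u i) : p * m = m := by
  set w : M.carrier := (1 - p) * m with hw
  have hpp : p * p = p := hp.isIdempotentElem
  have hpw : (1 - p) * w = w := by
    rw [hw, ← mul_assoc]; congr 1
    rw [mul_sub, mul_one, sub_mul, one_mul, hpp]; abel
  have hn1 : ‖1 - p‖ ≤ 1 := hp.one_sub.norm_le
  have key : ∀ n : ℕ, ‖m + (n : ℂ) • w‖ ^ 2 ≤ 1 + n ^ 2 * ‖w‖ ^ 2 := by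
    intro n
    have h1 : ‖m + (n : ℂ) • w‖ ≤ Real.sqrt (1 + n ^ 2 * ‖w‖ ^ 2) := by
      refine WTendsto.norm_le (u := fun i => u i + (n : ℂ) • w) (h.add (WTendsto.const _))
        (Real.sqrt_nonneg _) (.of_forall fun i => ?_)
      apply Real.le_sqrt_of_sq_le
      have h0 : star (u i) * w = 0 := by
        rw [← hpu i, star_mul, hp.isSelfAdjoint.star_eq, hw, mul_assoc, ← mul_assoc p, mul_sub,
          mul_one, hpp, sub_self, zero_mul, mul_zero]
      have h0' : star w * u i = 0 := by
        have := congrArg star h0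
        simpa using this
      rw [sq, ← CStarRing.norm_star_mul_self]
      have e : star (u i + (n : ℂ) • w) * (u i + (n : ℂ) • w) =
          star (u i) * u i + ((n : ℂ) ^ 2) • (star w * w) := by
        simp only [star_add, star_smul, add_mul, mul_add, smul_mul_assoc, mul_smul_comm, h0, h0',
          smul_zero, add_zero, zero_add, smul_smul, star_natCast, sq]
      rw [e]
      calc _ ≤ ‖star (u i) * u i‖ + ‖((n : ℂ) ^ 2) • (star w * w)‖ := norm_add_le _ _
        _ = ‖u i‖ * ‖u i‖ + n ^ 2 * ‖w‖ ^ 2 := by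
          rw [CStarRing.norm_star_mul_self, norm_smul, CStarRing.norm_star_mul_self, norm_pow,
            Complex.norm_natCast, sq ‖w‖]
        _ ≤ _ := by nlinarith [hu i, norm_nonneg (u i)]
    exact (pow_le_pow_left₀ (norm_nonneg _) h1 2).trans (Real.sq_sqrt (by positivity)).le
  have key2 : ∀ n : ℕ, (1 + n) * ‖w‖ ≤ ‖m + (n : ℂ) • w‖ := by
    intro n
    have e : ((1 + n : ℝ) : ℂ) • w = (1 - p) * (m + (n : ℂ) • w) := by
      rw [mul_add, mul_smul_comm, hpw, ← hw]; push_cast; module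
    calc (1 + n) * ‖w‖ = ‖((1 + n : ℝ) : ℂ) • w‖ := by
          rw [norm_smul, Complex.norm_real, Real.norm_of_nonneg (by positivity)]
      _ ≤ ‖1 - p‖ * ‖m + (n : ℂ) • w‖ := by rw [e]; exact norm_mul_le _ _
      _ ≤ _ := mul_le_of_le_one_left (norm_nonneg _) hn1
  have hw0 : w = 0 := by
    by_contra hne
    have hpos : 0 < ‖w‖ := norm_pos_iff.2 hne
    obtain ⟨n, hn⟩ := exists_nat_gt (‖w‖ ^ 2)⁻¹
    have h1 := (pow_le_pow_left₀ (by positivity) (key2 n) 2).trans (key n)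
    have h2 : 1 < n * ‖w‖ ^ 2 := by
      rwa [inv_lt_iff_one_lt_mul₀ (by positivity)] at hn
    nlinarith
  rw [hw, sub_mul, one_mul, sub_eq_zero] at hw0
  exact hw0.symm

/-- If `u` tends to `0`, the limits of `p u` and `(1 - p) u` lie in `p M` and `(1 - p) M` and add up
to `0`, so both vanish. -/
theorem comp_mulLeft_projection_mem {p : M.carrier} (hp : IsStarProjection p) (x : M.predual) :
    (M.ev x).comp (ContinuousLinearMap.mul ℂ M.carrier p) ∈ M.normalDual := by
  apply mem_normalDual_of_ultrafilter
  intro u U hu hw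
  have hpp : p * p = p := hp.isIdempotentElem
  have hqq : (1 - p) * (1 - p) = 1 - p := hp.one_sub.isIdempotentElem
  have hb : ∀ {q : M.carrier}, ‖q‖ ≤ 1 → ∀ i, ‖q * u i‖ ≤ 1 := fun hq i =>
    (norm_mul_le _ _).trans (mul_le_one₀ hq (norm_nonneg _) (hu i))
  obtain ⟨y, hy⟩ := M.exists_wTendsto (fun i => p * u i) U (.of_forall (hb hp.norm_le))
  obtain ⟨z, hz⟩ := M.exists_wTendsto (fun i => (1 - p) * u i) U (.of_forall (hb hp.one_sub.norm_le))
  have hpy := hy.projection_mul hp (hb hp.norm_le) fun i => by rw [← mul_assoc, hpp]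
  have hpz := hz.projection_mul hp.one_sub (hb hp.one_sub.norm_le) fun i => by
    rw [← mul_assoc, hqq]
  have h0 : y + z = 0 := by
    refine ((hy.add hz).congr' (.of_forall fun i => ?_)).unique hw
    rw [← add_mul]; simp
  have hpz0 : p * z = 0 := by
    rw [← hpz, ← mul_assoc, mul_sub, mul_one, hpp, sub_self, zero_mul]
  have hy0 : y = 0 := by
    have := congrArg (p * ·) h0
    simpa [mul_add, hpy, hpz0] using this
  have := hy x
  rw [hy0, map_zero] at this
  exact this

/-- The elements `a` with this property form a norm-closed subspace, because the predual is
norm-closed in the dual; it contains the projections, whose span is dense. -/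
theorem comp_mulLeft_mem {F : StrongDual ℂ M.carrier} (hF : F ∈ M.normalDual) (a : M.carrier) :
    F.comp (ContinuousLinearMap.mul ℂ M.carrier a) ∈ M.normalDual := by
  obtain ⟨x, rfl⟩ := hF
  let L : M.carrier →L[ℂ] StrongDual ℂ M.carrier :=
    (ContinuousLinearMap.compL ℂ M.carrier M.carrier ℂ (M.ev x)).comp
      (ContinuousLinearMap.mul ℂ M.carrier)
  have hcl : IsClosed ((M.normalDual.comap L.toLinearMap : Submodule ℂ M.carrier) : Set M.carrier) :=
    M.isClosed_normalDual.preimage L.continuous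
  have h : (⊤ : Submodule ℂ M.carrier) ≤ M.normalDual.comap L.toLinearMap := by
    rw [← M.span_projection_dense]
    refine Submodule.topologicalClosure_minimal _ (Submodule.span_le.2 fun p hp => ?_) hcl
    exact comp_mulLeft_projection_mem hp x
  exact h (Submodule.mem_top (x := a))

/-- Left multiplications are normal. -/
theorem exists_ev_mul_left (M : WStar) (x : M.predual) (a : M.carrier) :
    ∃ y, ∀ m, M.ev y m = M.ev x (a * m) := by
  obtain ⟨y, hy⟩ := comp_mulLeft_mem (M.ev_mem_normalDual x) a
  exact ⟨y, fun m => DFunLike.congr_fun hy m⟩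

/-- The involution is normal. -/
theorem exists_ev_star (M : WStar) (x : M.predual) : ∃ y, ∀ m, M.ev y m = star (M.ev x (star m)) := by
  obtain ⟨y, hy⟩ := adjointFunctional_mem (M.ev_mem_normalDual x)
  exact ⟨y, fun m => DFunLike.congr_fun hy m⟩

/-- Right multiplications are normal. -/
theorem exists_ev_mul_right (M : WStar) (x : M.predual) (a : M.carrier) :
    ∃ y, ∀ m, M.ev y m = M.ev x (m * a) := by
  obtain ⟨y, hy⟩ := M.exists_ev_star x
  obtain ⟨z, hz⟩ := M.exists_ev_mul_left y (star a)
  obtain ⟨w, hw⟩ := M.exists_ev_star z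
  exact ⟨w, fun m => by rw [hw, hz, hy]; simp⟩

theorem WTendsto.mul_left {l : Filter ι} (h : M.WTendsto u l m) (a : M.carrier) :
    M.WTendsto (fun i => a * u i) l (a * m) := fun x => by
  obtain ⟨y, hy⟩ := M.exists_ev_mul_left x a
  simpa only [hy] using h y

end WStar

namespace WStar

/-! ### `w*`-closed subalgebras -/

/-- A set is `w*`-closed as a subspace if it contains every element annihilated by all normal
functionals annihilating the set. -/
def IsWClosed (M : WStar) (S : Set M.carrier) : Prop :=
  ∀ m, (∀ x, (∀ s ∈ S, M.ev x s = 0) → M.ev x m = 0) → m ∈ S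

variable {M N : WStar} {S : Set M.carrier}

theorem IsWClosed.isClosed (hS : M.IsWClosed S) : IsClosed S := by
  refine isClosed_of_closure_subset fun m hm => hS m fun x hx => ?_
  have h : IsClosed {m | M.ev x m = 0} := isClosed_eq (M.ev x).continuous continuous_const
  exact closure_minimal hx h hm

theorem IsWClosed.mem_of_wTendsto (hS : M.IsWClosed S) {ι : Type*} {l : Filter ι} [l.NeBot]
    {u : ι → M.carrier} {m : M.carrier} (h : M.WTendsto u l m) (hu : ∀ᶠ i in l, u i ∈ S) : m ∈ S :=
  hS m fun x hx => tendsto_nhds_unique (h x)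
    (tendsto_const_nhds.congr' (hu.mono fun _ hi => (hx _ hi).symm))

/-- Normality of a map of W*-algebras in terms of the preduals. -/
def IsNormalMap (M N : WStar) (k : M.carrier → N.carrier) : Prop :=
  ∀ y, ∃ x, ∀ m, M.ev x m = N.ev y (k m)

theorem Hom.isNormalMap (f : M ⟶ N) : IsNormalMap M N f := fun y => by
  obtain ⟨x, hx⟩ := f.comp_mem_normalDual (N.ev_mem_normalDual y)
  exact ⟨x, fun a => DFunLike.congr_fun hx a⟩

theorem IsNormalMap.comp {R : WStar} {k : M.carrier → N.carrier} {l : N.carrier → R.carrier}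
    (hl : IsNormalMap N R l) (hk : IsNormalMap M N k) : IsNormalMap M R fun m => l (k m) := fun z => by
  obtain ⟨y, hy⟩ := hl z
  obtain ⟨x, hx⟩ := hk y
  exact ⟨x, fun m => (hx m).trans (hy _)⟩

theorem isNormalMap_mul_left (a : M.carrier) : IsNormalMap M M fun m => a * m :=
  fun y => M.exists_ev_mul_left y a

theorem isNormalMap_mul_right (a : M.carrier) : IsNormalMap M M fun m => m * a :=
  fun y => M.exists_ev_mul_right y a

theorem isWClosed_eq {k l : M.carrier → N.carrier} (hk : IsNormalMap M N k)
    (hl : IsNormalMap M N l) : M.IsWClosed {m | k m = l m} := by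
  refine fun m hm => N.ext_ev fun y => ?_
  obtain ⟨x, hx⟩ := hk y
  obtain ⟨z, hz⟩ := hl y
  have := hm (x - z) fun s hs => by
    rw [map_sub, _root_.sub_apply, hx, hz, hs, sub_self]
  rwa [map_sub, _root_.sub_apply, hx, hz, sub_eq_zero] at this

theorem IsWClosed.iInter {ι : Sort*} {T : ι → Set M.carrier} (hT : ∀ i, M.IsWClosed (T i)) :
    M.IsWClosed (⋂ i, T i) := fun m hm => Set.mem_iInter.2 fun i =>
  hT i m fun x hx => hm x fun _ hs => hx _ (Set.mem_iInter.1 hs i)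

/-- The pre-annihilator of a set. -/
def preann (M : WStar) (S : Set M.carrier) : Submodule ℂ M.predual where
  carrier := {x | ∀ s ∈ S, M.ev x s = 0}
  add_mem' hx hy s hs := by
    rw [map_add, _root_.add_apply, hx s hs, hy s hs, add_zero]
  zero_mem' s _ := by simp
  smul_mem' c x hx s hs := by
    rw [map_smul, _root_.smul_apply, hx s hs, smul_zero]

theorem mem_preann {x : M.predual} : x ∈ M.preann S ↔ ∀ s ∈ S, M.ev x s = 0 := Iff.rfl

theorem isClosed_preann (M : WStar) (S : Set M.carrier) :
    IsClosed (M.preann S : Set M.predual) := by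
  have : (M.preann S : Set M.predual) = ⋂ s ∈ S, {x | M.ev x s = 0} := by
    ext x; simp [mem_preann]
  rw [this]
  refine isClosed_biInter fun s _ => isClosed_eq ?_ continuous_const
  exact (M.dualEquiv s).continuous

variable (A : StarSubalgebra ℂ M.carrier) (hA : M.IsWClosed A)

/-- A `w*`-closed subalgebra is the dual of a quotient of the predual. -/
def subDualEquiv (hA : M.IsWClosed A) :
    A ≃ₗᵢ[ℂ] StrongDual ℂ (M.predual ⧸ M.preann (A : Set M.carrier)) :=
  LinearIsometryEquiv.ofSurjective
    { toFun := fun a => (M.preann (A : Set M.carrier)).liftQL (M.dualEquiv a) fun x hx => hx a a.2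
      map_add' := fun a b => by
        ext q
        obtain ⟨x, rfl⟩ := Submodule.Quotient.mk_surjective _ q
        change M.dualEquiv (a + b : M.carrier) x = M.dualEquiv a x + M.dualEquiv b x
        rw [map_add]; rfl
      map_smul' := fun c a => by
        ext q
        obtain ⟨x, rfl⟩ := Submodule.Quotient.mk_surjective _ q
        change M.dualEquiv (c • a : M.carrier) x = c • M.dualEquiv a x
        rw [map_smul]; rfl
      norm_map' := fun a => by
        change ‖(M.preann (A : Set M.carrier)).liftQL (M.dualEquiv a) _‖ = ‖(a : M.carrier)‖
        rw [← M.dualEquiv.norm_map]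
        apply le_antisymm
        · refine ContinuousLinearMap.opNorm_le_bound _ (norm_nonneg _) fun q => ?_
          refine le_of_forall_pos_le_add fun ε hε => ?_
          -- The tolerance is divided by `‖M.dualEquiv a‖ + 1` because the norm itself may vanish.
          obtain ⟨x, rfl, hx⟩ := Submodule.Quotient.norm_mk_lt q
            (ε := ε / (‖M.dualEquiv a‖ + 1)) (by positivity)
          change ‖M.dualEquiv a x‖ ≤ _
          set r := ‖M.dualEquiv (a : M.carrier)‖ with hr
          have hr0 : 0 ≤ r := norm_nonneg _
          have h1 : r / (r + 1) * ε ≤ 1 * ε := by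
            gcongr
            rw [div_le_one (by positivity)]; linarith
          have h2 := mul_le_mul_of_nonneg_left hx.le hr0
          have h3 := ContinuousLinearMap.le_opNorm (M.dualEquiv (a : M.carrier)) x
          rw [mul_add, ← mul_comm_div, one_mul] at *
          linarith
        · refine ContinuousLinearMap.opNorm_le_bound _ (ContinuousLinearMap.opNorm_nonneg _) fun x => ?_
          refine (ContinuousLinearMap.le_opNorm
            ((M.preann (A : Set M.carrier)).liftQL (M.dualEquiv a) fun x hx => hx a a.2)
            (Submodule.Quotient.mk x)).trans ?_
          gcongr
          exact Submodule.Quotient.norm_mk_le _ x }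
    (by
      intro g
      -- A functional on the quotient, pulled back to the predual of `M`, is an element of `M`
      -- killed by the pre-annihilator of `A`, so it lies in `A` by `w*`-closedness.
      set m : M.carrier := M.dualEquiv.symm (g.comp (M.preann (A : Set M.carrier)).mkQL) with hm
      have hev : ∀ x, M.ev x m = g (Submodule.Quotient.mk x) := fun x => by
        rw [ev_apply, hm, LinearIsometryEquiv.apply_symm_apply]; rfl
      have hmA : m ∈ A := hA m fun x hx => by
        rw [hev, (Submodule.Quotient.mk_eq_zero _).2 (show x ∈ M.preann _ from hx), map_zero]
      refine ⟨⟨m, hmA⟩, ?_⟩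
      ext q
      obtain ⟨x, rfl⟩ := Submodule.Quotient.mk_surjective _ q
      exact hev x)

/-- A `w*`-closed subalgebra as a W*-algebra. -/
@[reducible] def sub (hA : M.IsWClosed A) : WStar :=
  letI := hA.isClosed
  letI := M.isClosed_preann (A : Set M.carrier)
  { carrier := A
    cstarAlgebra := StarSubalgebra.cstarAlgebra A
    predual := M.predual ⧸ M.preann (A : Set M.carrier)
    dualEquiv := subDualEquiv A hA }

/-- The inclusion of a `w*`-closed subalgebra. -/
def subι : sub A hA ⟶ M where
  toStarAlgHom := (A.subtype : A →⋆ₐ[ℂ] M.carrier)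
  normal := by
    rw [normal_iff]
    intro x
    exact (sub A hA).continuous_eval (Submodule.Quotient.mk x)

/-- Corestriction of a morphism to a `w*`-closed subalgebra. -/
def subLift (f : N ⟶ M) (hf : ∀ n, f n ∈ A) : N ⟶ sub A hA where
  toStarAlgHom := (f.toStarAlgHom.codRestrict A hf : N.carrier →⋆ₐ[ℂ] A)
  normal := by
    rw [normal_iff]
    intro q
    obtain ⟨x, rfl⟩ := Submodule.Quotient.mk_surjective _ q
    exact (normal_iff _).1 f.normal x

/-- The `w*`-closure of a `*`-subalgebra. -/
def wClosure : StarSubalgebra ℂ M.carrier where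
  carrier := {m | ∀ x, (∀ s ∈ A, M.ev x s = 0) → M.ev x m = 0}
  add_mem' ha hb x hx := by rw [map_add, ha x hx, hb x hx, add_zero]
  mul_mem' {a b} ha hb x hx := by
    -- Multiplication is only separately normal, so the factors are treated one at a time: for `s`
    -- in `A` the functional `x (s ·)` kills `A`, hence `b`; thus `x (· b)` kills `A`, hence `a`.
    obtain ⟨y, hy⟩ := M.exists_ev_mul_right x b
    rw [← hy]
    refine ha y fun s hs => ?_
    obtain ⟨z, hz⟩ := M.exists_ev_mul_left x s
    rw [hy, ← hz]
    exact hb z fun t ht => by rw [hz]; exact hx _ (mul_mem hs ht)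
  algebraMap_mem' c x hx := hx _ (A.algebraMap_mem c)
  star_mem' {a} ha x hx := by
    obtain ⟨y, hy⟩ := M.exists_ev_star x
    have := ha y fun s hs => by rw [hy, hx _ (star_mem hs), star_zero]
    rw [hy] at this
    exact star_eq_zero.1 this

theorem le_wClosure : A ≤ wClosure A := fun _ ha _ hx => hx _ ha

theorem isWClosed_wClosure : M.IsWClosed (wClosure A) :=
  fun _ hm x hx => hm x fun _ hs => hs x hx

/-- The W*-subalgebra on which two morphisms agree. -/
def eqLocus (f g : M ⟶ N) : StarSubalgebra ℂ M.carrier where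
  carrier := {m | f m = g m}
  add_mem' {a b} ha hb := by simpa using congr($ha + $hb)
  mul_mem' {a b} ha hb := by simpa using congr($ha * $hb)
  algebraMap_mem' c := (f.toStarAlgHom.toAlgHom.commutes c).trans
    (g.toStarAlgHom.toAlgHom.commutes c).symm
  star_mem' {a} ha := by simpa [map_star] using congr(star $ha)

/-! ### Units of `w*`-closed ideals -/

/-- A `w*`-closed `*`-invariant left ideal contains an element acting as a right unit. -/
theorem exists_unit_of_isWClosed (K : NonUnitalStarSubalgebra ℂ M.carrier)
    (hK : M.IsWClosed (K : Set M.carrier)) : ∃ e ∈ K, ∀ x ∈ K, x * e = x := by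
  have := hK.isClosed
  let _ : PartialOrder K := CStarAlgebra.spectralOrder K
  have _ : StarOrderedRing K := CStarAlgebra.spectralOrderedRing K
  have hau := CStarAlgebra.increasingApproximateUnit K
  let l := CStarAlgebra.approximateUnit K
  have : l.NeBot := hau.neBot
  let U : Ultrafilter K := Ultrafilter.of l
  have hUl : (U : Filter K) ≤ l := Ultrafilter.of_le l
  -- The unit is a `w*`-limit of an approximate unit `k`: `x k` tends to `x e` by normality of
  -- multiplication and to `x` in norm.
  obtain ⟨e, he⟩ := M.exists_wTendsto (fun k : K => (k : M.carrier)) U (C := 1)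
    (hUl hau.eventually_norm)
  refine ⟨e, hK.mem_of_wTendsto he (.of_forall fun k => k.2), fun x hx => ?_⟩
  have h1 := he.mul_left x
  have h2 := (hau.tendsto_mul_left ⟨x, hx⟩).mono_left hUl
  refine h1.unique fun y => ?_
  exact ((M.ev y).continuous.comp continuous_subtype_val).tendsto _ |>.comp h2

end WStar

namespace WStar

/-! ### Products -/

theorem lp_one_summable_norm {ι : Type} {X : ι → Type} [∀ i, NormedAddCommGroup (X i)]
    (y : lp X 1) : Summable fun i => ‖y i‖ := by
  have := (lp.memℓp y).summable (by simp)
  simpa using this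

theorem lp_one_norm_eq {ι : Type} {X : ι → Type} [∀ i, NormedAddCommGroup (X i)]
    (y : lp X 1) : ‖y‖ = ∑' i, ‖y i‖ := by
  simpa using lp.norm_eq_tsum_rpow (by simp) y

section LpDual

variable {ι : Type} {E X : ι → Type} [∀ i, NormedAddCommGroup (E i)] [∀ i, NormedSpace ℂ (E i)]
  [∀ i, NormedAddCommGroup (X i)] [∀ i, NormedSpace ℂ (X i)]

variable (e : ∀ i, E i ≃ₗᵢ[ℂ] StrongDual ℂ (X i))

theorem lpPairing_bound (f : lp E ∞) (y : lp X 1) (i : ι) :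
    ‖e i (f i) (y i)‖ ≤ ‖f‖ * ‖y i‖ := by
  refine (ContinuousLinearMap.le_opNorm _ _).trans ?_
  rw [(e i).norm_map]
  gcongr
  exact lp.norm_apply_le_norm ENNReal.top_ne_zero f i

theorem lpPairing_summable (f : lp E ∞) (y : lp X 1) : Summable fun i => e i (f i) (y i) :=
  Summable.of_norm_bounded ((lp_one_summable_norm y).mul_left ‖f‖) fun i => lpPairing_bound e f y i

theorem norm_tsum_lpPairing_le (f : lp E ∞) (y : lp X 1) :
    ‖∑' i, e i (f i) (y i)‖ ≤ ‖f‖ * ‖y‖ := by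
  rw [lp_one_norm_eq, ← tsum_mul_left]
  exact tsum_of_norm_bounded ((lp_one_summable_norm y).mul_left ‖f‖).hasSum
    fun i => lpPairing_bound e f y i

/-- The functional on an `ℓ¹`-sum given by a bounded family of functionals. -/
def lpPairing (f : lp E ∞) : StrongDual ℂ (lp X 1) :=
  LinearMap.mkContinuous
    { toFun := fun y => ∑' i, e i (f i) (y i)
      map_add' := fun y z => by
        rw [← (lpPairing_summable e f y).tsum_add (lpPairing_summable e f z)]
        simp
      map_smul' := fun c y => by
        rw [RingHom.id_apply, smul_eq_mul, ← tsum_mul_left]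
        simp } ‖f‖ (norm_tsum_lpPairing_le e f)

theorem lpPairing_apply (f : lp E ∞) (y : lp X 1) : lpPairing e f y = ∑' i, e i (f i) (y i) := rfl

theorem lpPairing_single [DecidableEq ι] (f : lp E ∞) (i : ι) (x : X i) :
    lpPairing e f (lp.single 1 i x) = e i (f i) x := by
  rw [lpPairing_apply, tsum_eq_single i]
  · rw [lp.single_apply_self]
  · intro j hj
    rw [lp.single_apply_ne _ _ _ hj, map_zero]

/-- The dual of an `ℓ¹`-sum is the `ℓ^∞`-product of the duals. -/
def lpDualEquiv : lp E ∞ ≃ₗᵢ[ℂ] StrongDual ℂ (lp X 1) :=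
  LinearIsometryEquiv.ofSurjective
    { toFun := lpPairing e
      map_add' := fun f g => by
        ext y
        rw [_root_.add_apply, lpPairing_apply, lpPairing_apply, lpPairing_apply,
          ← (lpPairing_summable e f y).tsum_add (lpPairing_summable e g y)]
        simp
      map_smul' := fun c f => by
        ext y
        rw [_root_.smul_apply, lpPairing_apply, lpPairing_apply, RingHom.id_apply, smul_eq_mul,
          ← tsum_mul_left]
        simp
      norm_map' := fun f => by
        classical
        apply le_antisymm
        · exact ContinuousLinearMap.opNorm_le_bound _ (norm_nonneg _) (norm_tsum_lpPairing_le e f)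
        · refine lp.norm_le_of_forall_le (norm_nonneg _) fun i => ?_
          rw [← (e i).norm_map]
          refine ContinuousLinearMap.opNorm_le_bound _ (norm_nonneg _) fun x => ?_
          have := (lpPairing e f).le_opNorm (lp.single 1 i x)
          rwa [lpPairing_single, lp.norm_single zero_lt_one] at this }
    (by
      classical
      intro g
      let f0 : ∀ i, E i := fun i => (e i).symm (g.comp (lp.singleContinuousLinearMap ℂ X 1 i))
      have hf0 : ∀ i, ‖f0 i‖ ≤ ‖g‖ := fun i => by
        rw [LinearIsometryEquiv.norm_map]
        refine ContinuousLinearMap.opNorm_le_bound _ (norm_nonneg _) fun x => ?_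
        have := g.le_opNorm (lp.single 1 i x)
        rwa [lp.norm_single zero_lt_one] at this
      let f : lp E ∞ := ⟨f0, memℓp_infty ⟨‖g‖, by rintro _ ⟨i, rfl⟩; exact hf0 i⟩⟩
      refine ⟨f, ?_⟩
      ext y
      change lpPairing e f y = g y
      have h1 := (lp.hasSum_single ENNReal.one_ne_top y).mapL g
      rw [← h1.tsum_eq, lpPairing_apply]
      congr 1
      funext i
      change e i ((e i).symm _) (y i) = _
      rw [LinearIsometryEquiv.apply_symm_apply]
      rfl)

end LpDual

instance instCStarAlgebraLpInfty {ι : Type} {A : ι → Type} [∀ i, CStarAlgebra (A i)]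
    [∀ i, Nontrivial (A i)] : CStarAlgebra (lp A ∞) where

variable {ι : Type} (R : ι → WStar) [∀ i, Nontrivial (R i).carrier]

/-- The product of a family of nonzero W*-algebras. -/
@[reducible] def pi : WStar where
  carrier := lp (fun i => (R i).carrier) ∞
  cstarAlgebra := instCStarAlgebraLpInfty
  predual := lp (fun i => (R i).predual) 1
  dualEquiv := lpDualEquiv fun i => (R i).dualEquiv

/-- The projections of a product. -/
def piProj (i : ι) : pi R ⟶ R i where
  toStarAlgHom :=
    ({ toFun := fun f => f i
       map_one' := rfl
       map_mul' := fun _ _ => rfl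
       map_zero' := rfl
       map_add' := fun _ _ => rfl
       commutes' := fun _ => rfl
       map_star' := fun _ => rfl } : lp (fun i => (R i).carrier) ∞ →⋆ₐ[ℂ] (R i).carrier)
  normal := by
    classical
    rw [normal_iff]
    intro x
    convert (pi R).continuous_eval (lp.single 1 i x : lp (fun i => (R i).predual) 1) using 2 with f
    exact (lpPairing_single (fun i => (R i).dualEquiv) f i x).symm

/-- The morphism to a product with given components. -/
def piLift {M : WStar} (f : ∀ i, M ⟶ R i) : M ⟶ pi R where
  toStarAlgHom :=
    ({ toFun := fun m => ⟨fun i => f i m, memℓp_infty ⟨‖m‖, by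
          rintro _ ⟨i, rfl⟩; exact NonUnitalStarAlgHom.norm_apply_le (f i).toStarAlgHom m⟩⟩
       map_one' := by ext i; exact map_one (f i).toStarAlgHom
       map_mul' := fun a b => by ext i; exact map_mul (f i).toStarAlgHom a b
       map_zero' := by ext i; exact map_zero (f i).toStarAlgHom
       map_add' := fun a b => by ext i; exact map_add (f i).toStarAlgHom a b
       commutes' := fun c => by ext i; exact (f i).toStarAlgHom.toAlgHom.commutes c
       map_star' := fun a => by ext i; exact map_star (f i).toStarAlgHom a } :
      M.carrier →⋆ₐ[ℂ] lp (fun i => (R i).carrier) ∞)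
  normal := by
    rw [normal_iff]
    intro (y : lp (fun i => (R i).predual) 1)
    let F : ι → StrongDual ℂ M.carrier := fun i => ((R i).ev (y i)).comp (f i).toCLM
    have hF : ∀ i, F i ∈ M.normalDual := fun i => (f i).comp_mem_normalDual ((R i).ev_mem_normalDual _)
    have hn : ∀ i, ‖F i‖ ≤ ‖y i‖ := fun i => by
      refine ContinuousLinearMap.opNorm_le_bound _ (norm_nonneg _) fun m => ?_
      refine (((R i).ev (y i)).le_opNorm _).trans ?_
      rw [LinearIsometry.norm_map]
      gcongr
      exact NonUnitalStarAlgHom.norm_apply_le (f i).toStarAlgHom m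
    -- Normality into a product: the sum converges in norm because `y` is in `ℓ¹`, and the normal
    -- functionals are norm-closed.
    have hs : Summable F := Summable.of_norm_bounded (lp_one_summable_norm y) hn
    have hmem : ∑' i, F i ∈ M.normalDual :=
      M.isClosed_normalDual.mem_of_tendsto hs.hasSum
        (.of_forall fun s => Submodule.sum_mem _ fun i _ => hF i)
    have h2 := (M.continuous_iff_mem_normalDual _).2 hmem
    convert h2 using 2 with m
    have := (hs.hasSum.mapL (ContinuousLinearMap.apply ℂ ℂ m)).tsum_eq
    exact this

end WStar

namespace WStar

/-! ### Existence of categorical tensor products -/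

variable {M N : WStar}

theorem ev_zero_apply (M : WStar) (m : M.carrier) : M.ev 0 m = 0 := by simp

/-- The `*`-subalgebra spanned by the products of elements of two commuting images. -/
def productSpan {R : WStar} (f : M ⟶ R) (g : N ⟶ R)
    (h : ∀ (m : M.carrier) (n : N.carrier), f m * g n = g n * f m) : StarSubalgebra ℂ R.carrier where
  carrier := Submodule.span ℂ (Set.range fun p : M.carrier × N.carrier => f p.1 * g p.2)
  add_mem' := Submodule.add_mem _
  mul_mem' {a b} ha hb := by
    refine Submodule.span_induction (p := fun a _ => a * b ∈ Submodule.span ℂ _) ?_ ?_ ?_ ?_ ha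
    · rintro _ ⟨p, rfl⟩
      refine Submodule.span_induction
        (p := fun b _ => f p.1 * g p.2 * b ∈ Submodule.span ℂ _) ?_ ?_ ?_ ?_ hb
      · rintro _ ⟨q, rfl⟩
        refine Submodule.subset_span ⟨p * q, ?_⟩
        simp only [Prod.fst_mul, Prod.snd_mul, map_mul]
        rw [mul_assoc, mul_assoc, ← mul_assoc (f q.1), h, mul_assoc]
      · rw [mul_zero]; exact Submodule.zero_mem _
      · intro x y _ _ hx hy; rw [mul_add]; exact Submodule.add_mem _ hx hy
      · intro c x _ hx; rw [mul_smul_comm]; exact Submodule.smul_mem _ c hx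
    · rw [zero_mul]; exact Submodule.zero_mem _
    · intro x y _ _ hx hy; rw [add_mul]; exact Submodule.add_mem _ hx hy
    · intro c x _ hx; rw [smul_mul_assoc]; exact Submodule.smul_mem _ c hx
  algebraMap_mem' c := by
    rw [Algebra.algebraMap_eq_smul_one]
    refine Submodule.smul_mem _ c (Submodule.subset_span ⟨1, ?_⟩)
    simp
  star_mem' {a} ha := by
    refine Submodule.span_induction (p := fun a _ => star a ∈ Submodule.span ℂ _) ?_ ?_ ?_ ?_ ha
    · rintro _ ⟨p, rfl⟩
      refine Submodule.subset_span ⟨star p, ?_⟩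
      simp only [Prod.fst_star, Prod.snd_star, map_star, star_mul]
      rw [← map_star, ← map_star, h]
    · rw [star_zero]; exact Submodule.zero_mem _
    · intro x y _ _ hx hy; rw [star_add]; exact Submodule.add_mem _ hx hy
    · intro c x _ hx; rw [star_smul]; exact Submodule.smul_mem _ _ hx

theorem ev_productSpan_eq_zero {R : WStar} {f : M ⟶ R} {g : N ⟶ R}
    (h : ∀ (m : M.carrier) (n : N.carrier), f m * g n = g n * f m) {x : R.predual}
    (hx : ∀ m n, R.ev x (f m * g n) = 0) : ∀ s ∈ productSpan f g h, R.ev x s = 0 := by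
  intro s hs
  refine Submodule.span_induction (p := fun s _ => R.ev x s = 0) ?_ ?_ ?_ ?_ hs
  · rintro _ ⟨p, rfl⟩; exact hx _ _
  · exact map_zero _
  · intro a b _ _ ha hb; rw [map_add, ha, hb, add_zero]
  · intro c a _ ha; rw [map_smul, ha, smul_zero]

/-- A pair of morphisms with elementwise commuting images. -/
structure CommPair (M N : WStar) where
  pt : WStar
  inl : M ⟶ pt
  inr : N ⟶ pt
  commute : ∀ (m : M.carrier) (n : N.carrier), inl m * inr n = inr n * inl m

namespace CommPair

/-- A pair of morphisms generates its target if every `w*`-closed set containing the products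
is everything. -/
def Generates (P : CommPair M N) : Prop :=
  ∀ Z : Set P.pt.carrier, P.pt.IsWClosed Z → (∀ m n, P.inl m * P.inr n ∈ Z) → ∀ s, s ∈ Z

/-- The pair of corestrictions to the W*-subalgebra generated by the images. -/
@[reducible] def range (P : CommPair M N) : CommPair M N where
  pt := sub (wClosure (productSpan P.inl P.inr P.commute)) (isWClosed_wClosure _)
  inl := subLift _ _ P.inl fun m => le_wClosure _ (Submodule.subset_span ⟨(m, 1), by simp⟩)
  inr := subLift _ _ P.inr fun n => le_wClosure _ (Submodule.subset_span ⟨(1, n), by simp⟩)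
  commute m n := Subtype.ext (P.commute m n)

/-- The inclusion of the W*-subalgebra generated by the images. -/
def rangeι (P : CommPair M N) : P.range.pt ⟶ P.pt := subι _ _

/-- Normal functionals on the subalgebra are restrictions from the target. One that kills the
products kills their span and hence its `w*`-closure. -/
theorem generates_range (P : CommPair M N) : P.range.Generates := by
  intro Z hZ hprod s
  refine hZ s fun q hq => ?_
  obtain ⟨x, rfl⟩ := Submodule.Quotient.mk_surjective _ q
  have hx : ∀ m n, P.pt.ev x (P.inl m * P.inr n) = 0 := fun m n => hq _ (hprod m n)
  exact s.2 x (ev_productSpan_eq_zero P.commute hx)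

/-- Functionals of the form `(m, n) ↦ φ (m n)`, with `φ` a normal functional on the target of a
pair. -/
def IsRepresentable (M N : WStar) (ψ : M.carrier × N.carrier → ℂ) : Prop :=
  ∃ (P : CommPair M N) (x : P.pt.predual), ∀ p, ψ p = P.pt.ev x (P.inl p.1 * P.inr p.2)

/-- The nonzero representable functionals. -/
abbrev Index (M N : WStar) : Type :=
  {ψ : M.carrier × N.carrier → ℂ // IsRepresentable M N ψ ∧ ψ ≠ 0}

/-- A pair representing a functional. -/
def ofIndex (ψ : Index M N) : CommPair M N := ψ.2.1.choose

theorem ofIndex_spec (ψ : Index M N) : ∃ x : (ofIndex ψ).pt.predual, ∀ p,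
    ψ.1 p = (ofIndex ψ).pt.ev x ((ofIndex ψ).inl p.1 * (ofIndex ψ).inr p.2) :=
  ψ.2.1.choose_spec

/-- Excluding the zero functional keeps zero algebras out of the product, whose factors must be
nonzero. -/
instance nontrivial_ofIndex (ψ : Index M N) : Nontrivial (ofIndex ψ).pt.carrier := by
  by_contra h
  rw [not_nontrivial_iff_subsingleton] at h
  obtain ⟨x, hx⟩ := ofIndex_spec ψ
  exact ψ.2.2 (funext fun p => by rw [hx, Subsingleton.elim (_ * _) 0, map_zero]; rfl)

/-- The product of pairs representing all functionals. -/
@[reducible] def universalProduct (M N : WStar) : CommPair M N where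
  pt := pi fun ψ : Index M N => (ofIndex ψ).pt
  inl := piLift _ fun ψ => (ofIndex ψ).inl
  inr := piLift _ fun ψ => (ofIndex ψ).inr
  commute m n := by
    apply lp.ext
    funext ψ
    exact (ofIndex ψ).commute m n

/-- The generating pair representing all functionals. -/
@[reducible] def universal (M N : WStar) : CommPair M N := (universalProduct M N).range

/-- The representing functional is pulled back along the coordinate projection at `ψ`. The
functional `0` has no coordinate and is represented by `0`. -/
theorem exists_representing (ψ : M.carrier × N.carrier → ℂ) (hψ : IsRepresentable M N ψ) :
    ∃ y : (universal M N).pt.predual, ∀ m n,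
      (universal M N).pt.ev y ((universal M N).inl m * (universal M N).inr n) = ψ (m, n) := by
  by_cases h : ψ = 0
  · exact ⟨0, fun m n => (ev_zero_apply _ _).trans (by rw [h]; rfl)⟩
  obtain ⟨x, hx⟩ := ofIndex_spec ⟨ψ, hψ, h⟩
  obtain ⟨y, hy⟩ := Hom.isNormalMap ((universalProduct M N).rangeι ≫
    piProj (fun ψ : Index M N => (ofIndex ψ).pt) ⟨ψ, hψ, h⟩) x
  exact ⟨y, fun m n => (hy _).trans (hx (m, n)).symm⟩

theorem Generates.eq_of_ev {P : CommPair M N} (hP : P.Generates) {x y : P.pt.predual}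
    (h : ∀ m n, P.pt.ev x (P.inl m * P.inr n) = P.pt.ev y (P.inl m * P.inr n)) : x = y := by
  apply P.pt.ev.injective
  ext s
  refine hP {s | P.pt.ev x s = P.pt.ev y s} (fun m hm => ?_) h s
  have := hm (x - y) fun s hs => by
    rw [map_sub, _root_.sub_apply, sub_eq_zero]; exact hs
  rwa [map_sub, _root_.sub_apply, sub_eq_zero] at this

theorem Generates.hom_ext {P : CommPair M N} (hP : P.Generates) {R : WStar} {h k : P.pt ⟶ R}
    (hl : P.inl ≫ h = P.inl ≫ k) (hr : P.inr ≫ h = P.inr ≫ k) : h = k := by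
  ext s
  refine hP {s | h s = k s} (isWClosed_eq h.isNormalMap k.isNormalMap) (fun m n => ?_) s
  have h1 : h (P.inl m) = k (P.inl m) := congrArg (fun q : M ⟶ R => q m) hl
  have h2 : h (P.inr n) = k (P.inr n) := congrArg (fun q : N ⟶ R => q n) hr
  change h _ = k _
  rw [map_mul, map_mul, h1, h2]

/-- A generating pair which represents all functionals represented by `P` maps to `P`. -/
theorem exists_hom {Q P : CommPair M N} (hQ : Q.Generates)
    (hrep : ∀ x : P.pt.predual, ∃ y : Q.pt.predual, ∀ m n,
      Q.pt.ev y (Q.inl m * Q.inr n) = P.pt.ev x (P.inl m * P.inr n)) :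
    ∃ h : Q.pt ⟶ P.pt, Q.inl ≫ h = P.inl ∧ Q.inr ≫ h = P.inr := by
  choose T0 hT0 using hrep
  let T1 : P.pt.predual →ₗ[ℂ] Q.pt.predual :=
    { toFun := T0
      map_add' := fun x y => hQ.eq_of_ev fun m n => by
        simp only [map_add, _root_.add_apply, hT0]
      map_smul' := fun c x => hQ.eq_of_ev fun m n => by
        simp only [map_smul, _root_.smul_apply, hT0, RingHom.id_apply] }
  -- No norm bound is assumed on the representing functionals. Boundedness comes from the closed
  -- graph theorem, as the values on products determine a functional on `Q.pt`.
  let T : P.pt.predual →L[ℂ] Q.pt.predual := ContinuousLinearMap.ofSeqClosedGraph (g := T1) (by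
    intro u x y hu hTu
    refine hQ.eq_of_ev fun m n => ?_
    have h1 : Filter.Tendsto (fun i => Q.pt.ev (T1 (u i)) (Q.inl m * Q.inr n)) Filter.atTop
        (𝓝 (Q.pt.ev y (Q.inl m * Q.inr n))) :=
      ((Q.pt.dualEquiv (Q.inl m * Q.inr n)).continuous.tendsto y).comp hTu
    have h2 : Filter.Tendsto (fun i => P.pt.ev (u i) (P.inl m * P.inr n)) Filter.atTop
        (𝓝 (P.pt.ev x (P.inl m * P.inr n))) :=
      ((P.pt.dualEquiv (P.inl m * P.inr n)).continuous.tendsto x).comp hu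
    have e : ∀ i, Q.pt.ev (T1 (u i)) (Q.inl m * Q.inr n) = P.pt.ev (u i) (P.inl m * P.inr n) :=
      fun i => hT0 (u i) m n
    simp only [e] at h1
    exact (tendsto_nhds_unique h1 h2).trans (hT0 x m n).symm)
  have hT : ∀ x m n, Q.pt.ev (T x) (Q.inl m * Q.inr n) = P.pt.ev x (P.inl m * P.inr n) := hT0
  -- The dual map of `T`, normal by construction. It respects products and adjoints on the
  -- generators `inl m * inr n`, and generation extends this to everything, for products one
  -- variable at a time.
  let k : Q.pt.carrier →ₗ[ℂ] P.pt.carrier :=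
    { toFun := fun s => P.pt.dualEquiv.symm ((Q.pt.dualEquiv s).comp T)
      map_add' := fun s t => by
        rw [← map_add, map_add, ContinuousLinearMap.add_comp]
      map_smul' := fun c s => by
        rw [← map_smul, map_smul, ContinuousLinearMap.smul_comp]; rfl }
  have hk : ∀ x s, P.pt.ev x (k s) = Q.pt.ev (T x) s := fun x s => by
    rw [ev_apply]
    change P.pt.dualEquiv (P.pt.dualEquiv.symm _) x = _
    rw [LinearIsometryEquiv.apply_symm_apply]
    rfl
  have hkn : IsNormalMap Q.pt P.pt k := fun x => ⟨T x, fun s => (hk x s).symm⟩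
  have hkp : ∀ m n, k (Q.inl m * Q.inr n) = P.inl m * P.inr n := fun m n =>
    P.pt.ext_ev fun x => by rw [hk, hT]
  have hk1 : k 1 = 1 := by
    have := hkp 1 1
    simpa using this
  have hmul1 : ∀ m n s, k (s * (Q.inl m * Q.inr n)) = k s * k (Q.inl m * Q.inr n) := by
    intro m n
    refine hQ {s | k (s * (Q.inl m * Q.inr n)) = k s * k (Q.inl m * Q.inr n)}
      (isWClosed_eq (hkn.comp (isNormalMap_mul_right _)) ((isNormalMap_mul_right _).comp hkn))
      fun m' n' => ?_
    have e : ∀ P : CommPair M N, P.inl m' * P.inr n' * (P.inl m * P.inr n) =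
        P.inl (m' * m) * P.inr (n' * n) := fun P => by
      rw [map_mul, map_mul, mul_assoc, mul_assoc, ← mul_assoc (P.inr n'), ← P.commute, mul_assoc]
    change k _ = k _ * k _
    rw [e Q, hkp, hkp, hkp, e P]
  have hmul : ∀ s t, k (s * t) = k s * k t := by
    intro s
    exact hQ {t | k (s * t) = k s * k t}
      (isWClosed_eq (hkn.comp (isNormalMap_mul_left _)) ((isNormalMap_mul_left _).comp hkn))
      fun m n => hmul1 m n s
  have hstar : ∀ s, star (k (star s)) = k s := by
    refine hQ {s | star (k (star s)) = k s} (isWClosed_eq (fun y => ?_) hkn) fun m n => ?_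
    · obtain ⟨z, hz⟩ := P.pt.exists_ev_star y
      obtain ⟨w, hw⟩ := hkn z
      obtain ⟨v, hv⟩ := Q.pt.exists_ev_star w
      exact ⟨v, fun s => by rw [hv, hw, hz, star_star]⟩
    · have e : ∀ P : CommPair M N, star (P.inl m * P.inr n) = P.inl (star m) * P.inr (star n) :=
        fun P => by rw [star_mul, map_star, map_star, ← map_star, ← map_star, P.commute]
      change star (k (star _)) = k _
      rw [e Q, hkp, hkp, ← e P, star_star]
  let h : Q.pt ⟶ P.pt :=
    { toStarAlgHom :=
        { toFun := k
          map_one' := hk1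
          map_mul' := hmul
          map_zero' := map_zero k
          map_add' := map_add k
          commutes' := fun c => by
            rw [Algebra.algebraMap_eq_smul_one, map_smul, hk1, Algebra.algebraMap_eq_smul_one]
          map_star' := fun s => by rw [← hstar (star s), star_star] }
      normal := by
        rw [normal_iff]
        intro y
        obtain ⟨x, hx⟩ := hkn y
        have e : (fun m => P.pt.dualEquiv (k m) y) = fun m => Q.pt.dualEquiv m x :=
          funext fun m => (hx m).symm
        exact e ▸ Q.pt.continuous_eval x }
  refine ⟨h, ?_, ?_⟩
  · ext m
    have := hkp m 1
    simp only [map_one, mul_one] at this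
    exact this
  · ext n
    have := hkp 1 n
    simp only [map_one, one_mul] at this
    exact this

end CommPair

theorem nonempty_categoricalTensor (M N : WStar) : Nonempty (CategoricalTensor M N) := by
  have hg := (CommPair.universalProduct M N).generates_range
  refine ⟨⟨(CommPair.universal M N).pt, (CommPair.universal M N).inl, (CommPair.universal M N).inr,
    (CommPair.universal M N).commute, fun R f g hc => ?_⟩⟩
  obtain ⟨h, hl, hr⟩ := CommPair.exists_hom (Q := CommPair.universal M N) (P := ⟨R, f, g, hc⟩) hg
    fun x => CommPair.exists_representing _ ⟨⟨R, f, g, hc⟩, x, fun _ => rfl⟩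
  exact ⟨h, ⟨hl, hr⟩, fun k hk => hg.hom_ext (hk.1.trans hl.symm) (hk.2.trans hr.symm)⟩

namespace CategoricalTensor

/-- The underlying pair of morphisms. -/
@[reducible] def toCommPair (T : CategoricalTensor M N) : CommPair M N :=
  ⟨T.pt, T.inl, T.inr, T.commute⟩

/-- The universal property factors the identity of `T.pt` through the W*-subalgebra generated by the
images, so that subalgebra is everything. -/
theorem generates (T : CategoricalTensor M N) : T.toCommPair.Generates := by
  intro Z hZ hprod s
  let P := T.toCommPair
  let r := T.desc P.range.inl P.range.inr P.range.commute
  have h : r ≫ P.rangeι = 𝟙 T.pt := by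
    apply T.hom_ext
    · rw [← Category.assoc, T.inl_desc, Category.comp_id]; rfl
    · rw [← Category.assoc, T.inr_desc, Category.comp_id]; rfl
  have hs : P.rangeι (r s) = s := congrArg (fun q : T.pt ⟶ T.pt => q s) h
  have hmem := (r s).2
  have hs' : ((r s).1 : T.pt.carrier) = s := hs
  rw [hs'] at hmem
  exact hZ s fun x hx => hmem x (ev_productSpan_eq_zero T.commute fun m n => hx _ (hprod m n))

/-- The products `inl m * inr n` commute with each other; separate normality extends this to one
arbitrary factor, then to both. -/
theorem isCommutative_pt (T : CategoricalTensor M N) (hM : isCommutative M)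
    (hN : isCommutative N) : isCommutative T.pt := by
  have h1 : ∀ m n m' n', (T.inl m * T.inr n) * (T.inl m' * T.inr n') =
      (T.inl m' * T.inr n') * (T.inl m * T.inr n) := by
    have e : ∀ m n m' n', (T.inl m * T.inr n) * (T.inl m' * T.inr n') =
        T.inl (m * m') * T.inr (n * n') := fun m n m' n' => by
      rw [map_mul, map_mul, mul_assoc, mul_assoc, ← mul_assoc (T.inr n), ← T.commute, mul_assoc]
    intro m n m' n'
    rw [e, e, hM m m', hN n n']
  have h2 : ∀ a m n, a * (T.inl m * T.inr n) = (T.inl m * T.inr n) * a := fun a m n =>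
    T.generates {a | a * (T.inl m * T.inr n) = (T.inl m * T.inr n) * a}
      (isWClosed_eq (isNormalMap_mul_right _) (isNormalMap_mul_left _))
      (fun m' n' => h1 m' n' m n) a
  intro a b
  exact T.generates {b | a * b = b * a}
    (isWClosed_eq (isNormalMap_mul_left _) (isNormalMap_mul_right _)) (fun m n => h2 a m n) b

end CategoricalTensor

end WStar

namespace WStar

/-! ### Scalars -/

/-- A morphism whose values are scalars factors through `ℂ`. -/
theorem existsUnique_comp_unit {R N : WStar} [Nontrivial N.carrier] (f : R ⟶ N)
    (hf : ∀ m, ∃ c : ℂ, f m = c • (1 : N.carrier)) : ∃! g : R ⟶ complex, g ≫ unit N = f := by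
  have hunit : ∀ c : ℂ, unit N c = c • (1 : N.carrier) := fun c => Algebra.algebraMap_eq_smul_one c
  have hinj : ∀ c d : ℂ, c • (1 : N.carrier) = d • (1 : N.carrier) → c = d := fun c d h =>
    smul_left_injective ℂ (one_ne_zero (α := N.carrier)) h
  choose k hk using hf
  -- A normal functional not vanishing at `1` reads off the scalar, so the scalar depends normally
  -- on `m`.
  obtain ⟨y, hy⟩ : ∃ y, N.ev y 1 ≠ 0 := by
    by_contra! h
    exact one_ne_zero (N.ext_ev fun x => by rw [h, map_zero])
  have hky : ∀ m, k m = N.ev y (f m) / N.ev y 1 := fun m => by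
    rw [hk, map_smul, smul_eq_mul, mul_div_cancel_right₀ _ hy]
  let g : R ⟶ complex :=
    { toStarAlgHom :=
        { toFun := k
          map_one' := hinj _ _ (by rw [← hk, map_one, one_smul])
          map_mul' := fun a b => hinj _ _ (by
            rw [← hk, map_mul, hk, hk, smul_mul_smul_comm, one_mul])
          map_zero' := hinj _ _ (by rw [← hk, map_zero, zero_smul])
          map_add' := fun a b => hinj _ _ (by rw [← hk, map_add, hk, hk, add_smul])
          commutes' := fun c => hinj _ _ (by
            rw [← hk]
            exact (f.toStarAlgHom.toAlgHom.commutes c).trans (hunit c))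
          map_star' := fun a => hinj _ _ (by rw [← hk, map_star, hk, star_smul, star_one]) }
      normal := by
        rw [normal_iff]
        intro c
        obtain ⟨x, hx⟩ := f.isNormalMap ((c / N.ev y 1) • y)
        convert R.continuous_eval x using 2 with m
        change (c : ℂ) • (k m) = R.ev x m
        rw [hx, map_smul, hky]
        change (c : ℂ) * (N.ev y (f m) / N.ev y 1) = (c / N.ev y 1) * N.ev y (f m)
        ring }
  refine ⟨g, ?_, fun g' hg' => ?_⟩
  · ext m
    exact (hunit _).trans (hk m).symm
  · ext m
    refine hinj _ _ ?_
    rw [← hunit, ← hunit]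
    have h1 : unit N (g' m) = f m := congrArg (fun q : R ⟶ N => q m) hg'
    exact h1.trans ((hk m).trans (hunit _).symm)

/-! ### Ergodicity of irrational rotations -/

instance instFactTwoPi : Fact (0 < 2 * Real.pi) := ⟨Real.two_pi_pos⟩

theorem toCircle_coe (x : ℝ) : AddCircle.toCircle (x : AddCircle (2 * Real.pi)) = Circle.exp x := by
  rw [AddCircle.toCircle_apply_mk, div_self Real.two_pi_pos.ne', one_mul]

theorem measurePreserving_toCircle :
    MeasurePreserving (AddCircle.toCircle (T := 2 * Real.pi)) volume circleMeasure := by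
  have hcont : Continuous (AddCircle.toCircle (T := 2 * Real.pi)) := AddCircle.continuous_toCircle
  have hmk := AddCircle.measurePreserving_mk (2 * Real.pi) (-Real.pi)
  refine ⟨hcont.measurable, ?_⟩
  rw [← hmk.map_eq, Measure.map_map hcont.measurable hmk.measurable, circleMeasure,
    show -Real.pi + 2 * Real.pi = Real.pi by ring]
  congr 1
  funext x
  exact toCircle_coe x

theorem circleMeasure_ne_zero : circleMeasure ≠ 0 := by
  intro h
  have h1 : circleMeasure Set.univ = 0 := by rw [h]; rfl
  rw [circleMeasure, Measure.map_apply (Circle.exp.continuous.measurable) MeasurableSet.univ] at h1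
  simp at h1
  exact absurd h1 (not_le.2 Real.pi_pos)

instance instNontrivialLinfty : Nontrivial (Lp ℂ ∞ circleMeasure) := by
  refine ⟨1, 0, fun h => ?_⟩
  have h1 : ∀ᵐ z ∂circleMeasure, (1 : ℂ) = 0 := by
    filter_upwards [LinftyAlg.coeFn_one (μ := circleMeasure), Lp.coeFn_zero ℂ ∞ circleMeasure]
      with z h1 h2
    rw [← h1, h, h2]; rfl
  have h2 : ∀ᵐ _ ∂circleMeasure, False := h1.mono fun _ h => one_ne_zero h
  rw [Filter.eventually_false_iff_eq_bot, ae_eq_bot] at h2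
  exact circleMeasure_ne_zero h2

instance instNontrivialLinftyCircle : Nontrivial linftyCircle.carrier := instNontrivialLinfty

/-- Carried over to `ℝ / 2πℤ`, the rotation becomes translation by `-2πθ`. Its multiples are dense
because `θ` is irrational, so it is ergodic and an invariant function is almost everywhere constant.
-/
theorem rotation_fixed_eq_smul_one {θ : ℝ} (hθ : Irrational θ) (f : linftyCircle.carrier)
    (hf : rotation (Circle.exp (2 * Real.pi * θ)) f = f) :
    ∃ c : ℂ, f = c • (1 : linftyCircle.carrier) := by
  let f' : Lp ℂ ∞ circleMeasure := f
  set w := Circle.exp (2 * Real.pi * θ) with hw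
  let a : AddCircle (2 * Real.pi) := ((-(2 * Real.pi * θ) : ℝ) : AddCircle (2 * Real.pi))
  have ha : AddCircle.toCircle a = w⁻¹ := by rw [toCircle_coe, hw, Circle.exp_neg]
  have herg : Ergodic (a + ·) volume := by
    rw [AddCircle.ergodic_add_left, ← AddCircle.denseRange_zsmul_iff,
      AddCircle.denseRange_zsmul_coe_iff, neg_div, mul_comm, mul_div_cancel_right₀ _
        Real.two_pi_pos.ne']
    exact hθ.neg
  have h1 : ∀ᵐ z ∂circleMeasure, f' (w⁻¹ * z) = f' z := by
    have := rotation_apply w f'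
    rw [show (rotation w f' : Lp ℂ ∞ circleMeasure) = f' from hf] at this
    exact this.symm
  have h2 := measurePreserving_toCircle.quasiMeasurePreserving.ae h1
  obtain ⟨c, hc⟩ := herg.ae_eq_const_of_ae_eq_comp_ae
    (g := fun x => f' (AddCircle.toCircle x))
    ((Lp.aestronglyMeasurable f').comp_measurePreserving measurePreserving_toCircle) (by
      filter_upwards [h2] with x hx
      rw [Function.comp_apply, AddCircle.toCircle_add, ha, hx])
  refine ⟨c, ?_⟩
  have h3 : ∀ᵐ z ∂circleMeasure, f' z = c := by
    have h4 : ∀ᵐ z ∂(Measure.map (AddCircle.toCircle (T := 2 * Real.pi)) volume), f' z = c :=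
      (ae_map_iff measurePreserving_toCircle.measurable.aemeasurable
        ((Lp.stronglyMeasurable f').measurable (measurableSet_singleton c))).2 hc
    rwa [measurePreserving_toCircle.map_eq] at h4
  change f' = c • (1 : Lp ℂ ∞ circleMeasure)
  apply Lp.ext
  filter_upwards [h3, Lp.coeFn_smul c (1 : Lp ℂ ∞ circleMeasure),
    LinftyAlg.coeFn_one (μ := circleMeasure)] with z h4 h5 h6
  rw [h4, h5, Pi.smul_apply, h6, smul_eq_mul, mul_one]

/-- `ℂ` is the equalizer of an irrational rotation and the identity. -/
theorem existsUnique_lift_rotationFork {θ : ℝ} (hθ : Irrational θ) {R : WStar}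
    (f : R ⟶ linftyCircle)
    (hf : f ≫ rotation (Circle.exp (2 * Real.pi * θ)) = f ≫ 𝟙 linftyCircle) :
    ∃! g : R ⟶ complex, g ≫ unit linftyCircle = f :=
  existsUnique_comp_unit f fun m => rotation_fixed_eq_smul_one hθ (f m)
    (congrArg (fun q : R ⟶ linftyCircle => q m) hf)

theorem nonempty_isLimit_rotationFork {θ : ℝ} (hθ : Irrational θ) :
    Nonempty (IsLimit (rotationFork (Circle.exp (2 * Real.pi * θ)))) :=
  ⟨Fork.IsLimit.ofExistsUnique fun s => existsUnique_lift_rotationFork hθ s.ι s.condition⟩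

theorem _root_.CommWStar.nonempty_isLimit_rotationFork {θ : ℝ} (hθ : Irrational θ) :
    Nonempty (IsLimit (CommWStar.rotationFork (Circle.exp (2 * Real.pi * θ)))) := by
  refine ⟨Fork.IsLimit.ofExistsUnique fun s => ?_⟩
  obtain ⟨g, hg, hu⟩ := existsUnique_lift_rotationFork hθ s.ι.hom
    (congrArg (fun q => q.hom) s.condition)
  refine ⟨ObjectProperty.homMk g, ObjectProperty.hom_ext _ hg, fun g' hg' => ?_⟩
  exact ObjectProperty.hom_ext _ (hu g'.hom (congrArg (fun q => q.hom) hg'))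

/-! ### The coordinate function and compositions of rotations -/

theorem rotation_one : rotation 1 = 𝟙 linftyCircle := by
  ext (f : Lp ℂ ∞ circleMeasure)
  apply Lp.ext (f := (rotation 1 f : Lp ℂ ∞ circleMeasure)) (g := f)
  filter_upwards [rotation_apply 1 f] with z hz
  rw [hz, inv_one, one_mul]

theorem rotation_comp_rotation (u v : Circle) : rotation u ≫ rotation v = rotation (u * v) := by
  ext (f : Lp ℂ ∞ circleMeasure)
  apply Lp.ext (f := (rotation v (rotation u f) : Lp ℂ ∞ circleMeasure))
    (g := (rotation (u * v) f : Lp ℂ ∞ circleMeasure))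
  filter_upwards [rotation_apply v (rotation u f), rotation_apply (u * v) f,
    (measurePreserving_circle_mul v⁻¹).quasiMeasurePreserving.ae (rotation_apply u f)]
    with z h1 h2 h3
  rw [h1, h2, h3, mul_inv, mul_assoc]

theorem memLp_circle_coe : MemLp (fun z : Circle => (z : ℂ)) ∞ circleMeasure :=
  memLp_top_of_bound (by fun_prop : Continuous fun z : Circle => (z : ℂ)).aestronglyMeasurable 1
    (.of_forall fun z => (Circle.norm_coe z).le)

/-- The coordinate function in `L^∞(𝕋)`. -/
def circleCoord : Lp ℂ ∞ circleMeasure := memLp_circle_coe.toLp _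

theorem circleCoord_mul_star : circleCoord * star circleCoord = 1 := by
  apply Lp.ext
  filter_upwards [LinftyAlg.coeFn_mul circleCoord (star circleCoord), Lp.coeFn_star circleCoord,
    memLp_circle_coe.coeFn_toLp, LinftyAlg.coeFn_one (μ := circleMeasure)] with z h1 h2 h3 h4
  rw [h1, h2, h4, Pi.star_apply, show circleCoord z = (z : ℂ) from h3, Complex.star_def,
    Complex.mul_conj, Circle.normSq_coe, Complex.ofReal_one]

theorem rotation_circleCoord (u : Circle) :
    (rotation u circleCoord : Lp ℂ ∞ circleMeasure) = ((u⁻¹ : Circle) : ℂ) • circleCoord := by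
  apply Lp.ext
  filter_upwards [rotation_apply u circleCoord, Lp.coeFn_smul ((u⁻¹ : Circle) : ℂ) circleCoord,
    memLp_circle_coe.coeFn_toLp, (measurePreserving_circle_mul u⁻¹).quasiMeasurePreserving.ae
      memLp_circle_coe.coeFn_toLp] with z h1 h2 h3 h4
  rw [h1, h2, Pi.smul_apply, show circleCoord z = (z : ℂ) from h3,
    show circleCoord (u⁻¹ * z) = ((u⁻¹ * z : Circle) : ℂ) from h4, Circle.coe_mul, smul_eq_mul]

end WStar

namespace WStar

/-! ### Failure of preservation of the equalizer -/

/-- If `w ^ k = -1`, then `2kθ` is an odd integer; this excludes `k = 0` and contradicts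
irrationality for `k ≠ 0`. -/
theorem exp_two_pi_mul_zpow_ne {θ : ℝ} (hθ : Irrational θ) (k : ℤ) :
    Circle.exp (2 * Real.pi * θ) ^ k ≠ Circle.exp Real.pi := by
  intro h
  rw [← Circle.exp_zsmul, Circle.exp_eq_exp] at h
  obtain ⟨m, hm⟩ := h
  have h1 : (2 * k : ℤ) * θ = (1 + 2 * m : ℤ) := by
    have : Real.pi * (2 * k * θ - (1 + 2 * m)) = 0 := by
      rw [zsmul_eq_mul] at hm; linear_combination hm
    rcases mul_eq_zero.1 this with h | h
    · exact absurd h Real.pi_ne_zero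
    · push_cast; linarith
  have hk : (2 * k : ℤ) ≠ 0 := by
    intro h0
    rw [h0, Int.cast_zero, zero_mul] at h1
    have : (0 : ℤ) = 1 + 2 * m := by exact_mod_cast h1
    omega
  have h2 : Irrational ((2 * k : ℤ) * θ) := hθ.intCast_mul hk
  rw [h1] at h2
  exact h2.ne_int _ rfl

/-- The midpoint of the unit vectors `1` and `-u` has norm `1` only if they coincide. -/
theorem norm_one_sub_div_two_lt {u : Circle} (hu : u ≠ Circle.exp Real.pi) :
    ‖(1 - (u : ℂ)) / 2‖ < 1 := by
  rw [norm_div, Complex.norm_two, div_lt_one zero_lt_two]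
  have h1 : ‖(1 - (u : ℂ))‖ ≤ 2 := (norm_sub_le _ _).trans (by rw [norm_one, Circle.norm_coe]; norm_num)
  refine lt_of_le_of_ne h1 fun h => hu (Circle.ext ?_)
  rw [Circle.coe_exp, Complex.exp_pi_mul_I]
  have h2 : Complex.normSq (u : ℂ) = 1 := Circle.normSq_coe u
  have h3 : Complex.normSq (1 - (u : ℂ)) = 4 := by rw [Complex.normSq_eq_norm_sq, h]; norm_num
  rw [Complex.normSq_apply] at h2 h3
  simp only [Complex.sub_re, Complex.one_re, Complex.sub_im, Complex.one_im, zero_sub] at h3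
  have hre : (u : ℂ).re = -1 := by linarith
  apply Complex.ext
  · rw [hre]; simp
  · rw [hre] at h2
    simp only [Complex.neg_im, Complex.one_im, neg_zero]
    nlinarith

variable (T : CategoricalTensor linftyCircle linftyCircle)

theorem isCommutative_linftyCircle : isCommutative linftyCircle := linfty_isCommutative circleMeasure

/-- The morphism `f ⊗ g ↦ ρ_u(f) g`. -/
def mulRotation (u : Circle) : T.pt ⟶ linftyCircle :=
  T.desc (rotation u) (𝟙 linftyCircle) fun _ _ => isCommutative_linftyCircle _ _

theorem inl_mulRotation (u : Circle) : T.inl ≫ mulRotation T u = rotation u := T.inl_desc _ _ _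

theorem inr_mulRotation (u : Circle) : T.inr ≫ mulRotation T u = 𝟙 _ := T.inr_desc _ _ _

/-- Thus `ρ_w ⊗ 1` shifts the morphisms indexed by the orbit of `w`, and their common kernel is
invariant. -/
theorem mapLeft_rotation_comp_mulRotation (u v : Circle) :
    T.mapLeft T (rotation u) ≫ mulRotation T v = mulRotation T (u * v) := by
  apply T.hom_ext
  · rw [← Category.assoc, T.inl_mapLeft, Category.assoc, inl_mulRotation, inl_mulRotation,
      rotation_comp_rotation]
  · rw [← Category.assoc, T.inr_mapLeft, inr_mulRotation, inr_mulRotation]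

theorem mapLeft_rotation_comp (u v : Circle) :
    T.mapLeft T (rotation u) ≫ T.mapLeft T (rotation v) = T.mapLeft T (rotation (u * v)) := by
  apply T.hom_ext
  · rw [← Category.assoc, T.inl_mapLeft, Category.assoc, T.inl_mapLeft, T.inl_mapLeft,
      ← Category.assoc, rotation_comp_rotation]
  · rw [← Category.assoc, T.inr_mapLeft, T.inr_mapLeft, T.inr_mapLeft]

theorem mapLeft_rotation_one : T.mapLeft T (rotation 1) = 𝟙 T.pt := by
  apply T.hom_ext
  · rw [T.inl_mapLeft, rotation_one, Category.id_comp, Category.comp_id]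
  · rw [T.inr_mapLeft, Category.comp_id]

/-- The common kernel of the morphisms `f ⊗ g ↦ ρ_u(f) g`, with `u` a power of `w`. -/
def orbitKernel (w : Circle) : NonUnitalStarSubalgebra ℂ T.pt.carrier where
  carrier := ⋂ k : ℤ, {x | mulRotation T (w ^ k) x = 0}
  add_mem' {a b} ha hb := by
    simp only [Set.mem_iInter, Set.mem_ofPred_eq] at *
    intro k; rw [map_add, ha, hb, add_zero]
  zero_mem' := by
    simp only [Set.mem_iInter, Set.mem_ofPred_eq]
    intro k; rw [map_zero]
  mul_mem' {a b} ha _ := by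
    simp only [Set.mem_iInter, Set.mem_ofPred_eq] at *
    intro k; rw [map_mul, ha, zero_mul]
  smul_mem' c a ha := by
    simp only [Set.mem_iInter, Set.mem_ofPred_eq] at *
    intro k; rw [map_smul, ha, smul_zero]
  star_mem' {a} ha := by
    simp only [Set.mem_iInter, Set.mem_ofPred_eq] at *
    intro k; rw [map_star, ha, star_zero]

theorem mem_orbitKernel {w : Circle} {x : T.pt.carrier} :
    x ∈ orbitKernel T w ↔ ∀ k : ℤ, mulRotation T (w ^ k) x = 0 := Set.mem_iInter

theorem isNormalMap_zero (M N : WStar) : IsNormalMap M N fun _ => 0 :=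
  fun _ => ⟨0, fun m => by simp⟩

theorem isWClosed_orbitKernel (w : Circle) :
    T.pt.IsWClosed (orbitKernel T w : Set T.pt.carrier) :=
  IsWClosed.iInter fun k => isWClosed_eq (mulRotation T (w ^ k)).isNormalMap (isNormalMap_zero _ _)

theorem mapLeft_mem_orbitKernel {w : Circle} (j : ℤ) {x : T.pt.carrier} (hx : x ∈ orbitKernel T w) :
    T.mapLeft T (rotation (w ^ j)) x ∈ orbitKernel T w := by
  rw [mem_orbitKernel] at *
  intro k
  rw [← comp_apply, mapLeft_rotation_comp_mulRotation, ← zpow_add]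
  exact hx _

/-- The unit of the common kernel is invariant. -/
theorem exists_invariant_unit (w : Circle) : ∃ e ∈ orbitKernel T w,
    (∀ x ∈ orbitKernel T w, x * e = x) ∧ T.mapLeft T (rotation w) e = e := by
  obtain ⟨e, he, hu⟩ := exists_unit_of_isWClosed (orbitKernel T w) (isWClosed_orbitKernel T w)
  refine ⟨e, he, hu, ?_⟩
  have hcomm := T.isCommutative_pt isCommutative_linftyCircle isCommutative_linftyCircle
  have h1 := mapLeft_mem_orbitKernel T 1 he
  have h2 := mapLeft_mem_orbitKernel T (-1) he
  rw [zpow_one] at h1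
  rw [zpow_neg_one] at h2
  have h3 : T.mapLeft T (rotation w) (T.mapLeft T (rotation w⁻¹) e) = e := by
    rw [← comp_apply, mapLeft_rotation_comp, inv_mul_cancel, mapLeft_rotation_one, id_apply]
  -- Apply `ρ_w ⊗ 1` to `e' * e = e'`, where `e'` is the image of `e` under the inverse rotation and
  -- lies in the ideal too. Together with `(ρ_w ⊗ 1)(e) * e = (ρ_w ⊗ 1)(e)` and commutativity this
  -- gives invariance.
  have h4 : e * T.mapLeft T (rotation w) e = e := by
    conv_lhs => rw [← h3]
    rw [← map_mul, h3, hu _ h2, h3]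
  rw [← hu _ h1, hcomm, h4]

/-- The coordinate function as an element of the W*-algebra `L^∞(𝕋)`. -/
def coord : linftyCircle.carrier := circleCoord

theorem coord_mul_star : coord * star coord = 1 := circleCoord_mul_star

theorem rotation_coord (u : Circle) : rotation u coord = ((u⁻¹ : Circle) : ℂ) • coord :=
  rotation_circleCoord u

theorem norm_coord_le : ‖coord‖ ≤ 1 := by
  have h1 : ‖coord * star coord‖ = ‖coord‖ * ‖coord‖ := CStarRing.norm_self_mul_star
  rw [coord_mul_star] at h1
  have := linftyCircle.norm_one_le
  nlinarith [norm_nonneg coord]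

/-- The unitary `z ⊗ z̄`. -/
def diagonalUnitary : T.pt.carrier := T.inl coord * T.inr (star coord)

theorem norm_diagonalUnitary_le : ‖diagonalUnitary T‖ ≤ 1 := by
  refine (norm_mul_le _ _).trans (mul_le_one₀ ?_ (norm_nonneg _) ?_)
  · exact (NonUnitalStarAlgHom.norm_apply_le T.inl.toStarAlgHom _).trans norm_coord_le
  · refine (NonUnitalStarAlgHom.norm_apply_le T.inr.toStarAlgHom _).trans ?_
    exact (norm_star coord).trans_le norm_coord_le

theorem mulRotation_diagonalUnitary (u : Circle) :
    mulRotation T u (diagonalUnitary T) = ((u⁻¹ : Circle) : ℂ) • (1 : linftyCircle.carrier) := by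
  rw [diagonalUnitary, map_mul, ← comp_apply, ← comp_apply, inl_mulRotation, inr_mulRotation,
    id_apply, rotation_coord, smul_mul_assoc, coord_mul_star]

theorem exists_mem_orbitKernel_ne_zero {θ : ℝ} (hθ : Irrational θ) :
    ∃ b ∈ orbitKernel T (Circle.exp (2 * Real.pi * θ)), b ≠ 0 := by
  set w := Circle.exp (2 * Real.pi * θ) with hw
  -- A contraction peaking where `z ⊗ z̄ = -1`: `mulRotation T u` sends it to the scalar `(1 - u⁻¹)
  -- / 2`, of modulus below `1` unless `u = -1`.
  let c : T.pt.carrier := (2⁻¹ : ℂ) • (1 - diagonalUnitary T)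
  have hc : ‖c‖ ≤ 1 := by
    rw [norm_smul, norm_inv, Complex.norm_two, inv_mul_le_iff₀ zero_lt_two]
    refine (norm_sub_le _ _).trans ?_
    linarith [T.pt.norm_one_le, norm_diagonalUnitary_le T]
  have hcn : ∀ n : ℕ, ‖c ^ n‖ ≤ 1 := fun n => by
    induction n with
    | zero => rw [pow_zero]; exact T.pt.norm_one_le
    | succ n ih =>
      rw [pow_succ]
      exact (norm_mul_le _ _).trans (mul_le_one₀ ih (norm_nonneg _) hc)
  have hmc : ∀ (u : Circle) (n : ℕ), mulRotation T u (c ^ n) =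
      (((1 - ((u⁻¹ : Circle) : ℂ)) / 2) ^ n) • (1 : linftyCircle.carrier) := fun u n => by
    have h1 : mulRotation T u c = ((1 - ((u⁻¹ : Circle) : ℂ)) / 2) • (1 : linftyCircle.carrier) := by
      simp only [c]
      rw [map_smul, map_sub, map_one, mulRotation_diagonalUnitary]
      module
    rw [map_pow, h1, smul_pow, one_pow]
  obtain ⟨b, hb⟩ := T.pt.exists_wTendsto (fun n : ℕ => c ^ n) (Filter.hyperfilter ℕ)
    (.of_forall hcn)
  refine ⟨b, ?_, fun h0 => ?_⟩
  · rw [mem_orbitKernel]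
    intro k
    refine (hb.map (mulRotation T (w ^ k))).unique fun y => ?_
    have hlt : ‖(1 - (((w ^ k)⁻¹ : Circle) : ℂ)) / 2‖ < 1 := by
      apply norm_one_sub_div_two_lt
      rw [← zpow_neg]
      exact exp_two_pi_mul_zpow_ne hθ _
    have h1 := (tendsto_pow_atTop_nhds_zero_of_norm_lt_one hlt).mono_left Nat.hyperfilter_le_atTop
    have h2 := h1.mul_const (linftyCircle.ev y 1)
    rw [zero_mul] at h2
    rw [map_zero]
    refine h2.congr fun n => ?_
    exact ((congrArg _ (hmc (w ^ k) n)).trans (by rw [map_smul, smul_eq_mul])).symm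
  -- At `u = -1` the scalar is exactly `1`, so every power of `c` has image `1`.
  · have h1 : mulRotation T (Circle.exp Real.pi) b = 1 := by
      refine (hb.map _).unique ((WTendsto.const 1).congr' (.of_forall fun n => ?_))
      rw [hmc, ← Circle.exp_neg, Circle.coe_exp]
      push_cast
      rw [neg_mul, Complex.exp_neg, Complex.exp_pi_mul_I]
      norm_num
    rw [h0, map_zero] at h1
    exact zero_ne_one h1

/-- The fixed points of `ρ_w ⊗ 1` do not all come from `ℂ ⊗ L^∞(𝕋)`. -/
theorem exists_fork_no_lift (TC : CategoricalTensor complex linftyCircle) {θ : ℝ}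
    (hθ : Irrational θ) : ∃ (R : WStar) (_ : isCommutative R) (k : R ⟶ T.pt),
      k ≫ T.mapLeft T (rotation (Circle.exp (2 * Real.pi * θ))) = k ≫ 𝟙 T.pt ∧
      ∀ h : R ⟶ TC.pt, h ≫ TC.mapLeft T (unit linftyCircle) ≠ k := by
  set w := Circle.exp (2 * Real.pi * θ) with hw
  let A := eqLocus (T.mapLeft T (rotation w)) (𝟙 T.pt)
  have hA : T.pt.IsWClosed (A : Set T.pt.carrier) := isWClosed_eq (Hom.isNormalMap _) (Hom.isNormalMap _)
  have hcomm := T.isCommutative_pt isCommutative_linftyCircle isCommutative_linftyCircle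
  refine ⟨sub A hA, fun a b => Subtype.ext (hcomm a b), subι A hA, ?_, fun h hh => ?_⟩
  · ext a
    exact a.2
  · obtain ⟨e, he, hu, hfix⟩ := exists_invariant_unit T w
    -- The first factor `ℂ` contributes only scalars, so `ι ⊗ 1` factors through `T.inr`, and `e`
    -- would be of the form `1 ⊗ g`.
    have h1 : TC.mapLeft T (unit linftyCircle) =
        TC.desc (unit linftyCircle) (𝟙 _) (fun _ _ => isCommutative_linftyCircle _ _) ≫ T.inr := by
      apply TC.hom_ext
      · rw [TC.inl_mapLeft, ← Category.assoc, TC.inl_desc, unit_comp, unit_comp]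
      · rw [TC.inr_mapLeft, ← Category.assoc, TC.inr_desc, Category.id_comp]
    rw [h1, ← Category.assoc] at hh
    have h2 := congrArg (fun q : sub A hA ⟶ T.pt => q (⟨e, hfix⟩ : A)) hh
    obtain ⟨g, hg⟩ : ∃ g, T.inr g = e := ⟨_, h2⟩
    -- Each `mulRotation` is the identity on the second factor, so killing `e = 1 ⊗ g` forces `g =
    -- 0`. Then `e = 0` is the unit of a nonzero ideal.
    have h3 := (mem_orbitKernel T).1 he 0
    rw [← hg, ← comp_apply, inr_mulRotation, id_apply] at h3
    rw [h3, map_zero] at hg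
    obtain ⟨b, hb, hb0⟩ := exists_mem_orbitKernel_ne_zero T hθ
    apply hb0
    rw [← hu b hb, ← hg, mul_zero]

end WStar

/-! ### From the lost equalizer to limits and adjoints -/

theorem not_preserves_of_isEmpty_isLimit_mapFork {C D : Type 1} [Category.{0} C] [Category.{0} D]
    (F : C ⥤ D) {X Y Z : C} {f g : X ⟶ Y} {h : Z ⟶ X} {w : h ≫ f = h ≫ g}
    (hl : Nonempty (IsLimit (Fork.ofι h w)))
    (hF : IsEmpty (IsLimit (mapFork F (Fork.ofι h w)))) :
    ¬ PreservesLimitsOfShape WalkingParallelPair F ∧ ¬ PreservesLimits F ∧ ¬ F.IsRightAdjoint := by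
  have h1 : ¬ PreservesLimitsOfShape WalkingParallelPair F := fun _ =>
    hF.false (isLimitForkMapOfIsLimit F w hl.some)
  have h2 : ¬ PreservesLimits F := fun _ => h1 inferInstance
  exact ⟨h1, h2, fun _ => h2 (Adjunction.ofIsRightAdjoint F).rightAdjoint_preservesLimits⟩

namespace WStar

variable (T : ∀ M, CategoricalTensor M linftyCircle)

theorem isEmpty_isLimit_mapFork {θ : ℝ} (hθ : Irrational θ) :
    IsEmpty (IsLimit (mapFork (tensorRight T) (rotationFork (Circle.exp (2 * Real.pi * θ))))) := by
  refine ⟨fun hl => ?_⟩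
  obtain ⟨R, -, k, hk, hno⟩ := exists_fork_no_lift (T linftyCircle) (T complex) hθ
  let l := Fork.IsLimit.lift' hl k
    (hk.trans (congrArg (k ≫ ·) ((tensorRight T).map_id linftyCircle).symm))
  exact hno l.1 l.2

end WStar

/-! ### The commutative case: tensor products as coproducts -/

namespace CommWStar

open WStar (CategoricalTensor)

variable (T : ∀ M, CategoricalTensor M WStar.linftyCircle)
  (hT : ∀ M, WStar.isCommutative M → WStar.isCommutative (T M).pt)

theorem isEmpty_isLimit_mapFork {θ : ℝ} (hθ : Irrational θ) :
    IsEmpty (IsLimit (mapFork (tensorRight T hT)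
      (rotationFork (Circle.exp (2 * Real.pi * θ))))) := by
  refine ⟨fun hl => ?_⟩
  obtain ⟨R, hR, k, hk, hno⟩ :=
    WStar.exists_fork_no_lift (T WStar.linftyCircle) (T WStar.complex) hθ
  let k' : (⟨R, hR⟩ : CommWStar) ⟶ (tensorRight T hT).obj linftyCircle := ObjectProperty.homMk k
  have hk' : k' ≫ (tensorRight T hT).map (rotation (Circle.exp (2 * Real.pi * θ))) =
      k' ≫ (tensorRight T hT).map (𝟙 linftyCircle) := by
    rw [(tensorRight T hT).map_id]
    exact ObjectProperty.hom_ext _ hk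
  let l := Fork.IsLimit.lift' hl k' hk'
  exact hno l.1.hom (congrArg (fun q => q.hom) l.2)

variable {M N : CommWStar}

/-- The cofan given by a commutative categorical tensor product. -/
def cofan (S : CategoricalTensor M.obj N.obj) (hS : WStar.isCommutative S.pt) : BinaryCofan M N :=
  BinaryCofan.mk (P := ⟨S.pt, hS⟩) (ObjectProperty.homMk S.inl) (ObjectProperty.homMk S.inr)

/-- Commutative categorical tensor products are coproducts. -/
def isColimitCofan (S : CategoricalTensor M.obj N.obj) (hS : WStar.isCommutative S.pt) :
    IsColimit (cofan S hS) :=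
  BinaryCofan.isColimitMk
    (fun s => ObjectProperty.homMk (S.desc s.inl.hom s.inr.hom fun _ _ => s.pt.property _ _))
    (fun s => ObjectProperty.hom_ext _
      (S.inl_desc s.inl.hom s.inr.hom fun _ _ => s.pt.property _ _))
    (fun s => ObjectProperty.hom_ext _
      (S.inr_desc s.inl.hom s.inr.hom fun _ _ => s.pt.property _ _))
    (fun s _ hl hr => ObjectProperty.hom_ext _ (S.hom_ext
      ((congrArg (fun q => q.hom) hl).trans
        (S.inl_desc s.inl.hom s.inr.hom fun _ _ => s.pt.property _ _).symm)
      ((congrArg (fun q => q.hom) hr).trans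
        (S.inr_desc s.inl.hom s.inr.hom fun _ _ => s.pt.property _ _).symm)))

theorem hasBinaryCoproducts : HasBinaryCoproducts CommWStar := by
  have : ∀ M N : CommWStar, HasColimit (pair M N) := fun M N => by
    obtain ⟨S⟩ := WStar.nonempty_categoricalTensor M.obj N.obj
    exact ⟨⟨_, isColimitCofan S (S.isCommutative_pt M.property N.property)⟩⟩
  exact hasBinaryCoproducts_of_hasColimit_pair _

section

variable [HasBinaryCoproducts CommWStar]

/-- The comparison of `M ⨿ L^∞(𝕋)` with `M ⊗ L^∞(𝕋)`. -/
def coprodIsoTensor (M : CommWStar) : M ⨿ linftyCircle ≅ (tensorRight T hT).obj M :=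
  (coprodIsCoprod M linftyCircle).coconePointUniqueUpToIso
    (isColimitCofan (N := linftyCircle) (T M.obj) (hT _ M.property))

theorem inl_coprodIsoTensor (M : CommWStar) :
    coprod.inl ≫ (coprodIsoTensor T hT M).hom = ObjectProperty.homMk (T M.obj).inl :=
  IsColimit.comp_coconePointUniqueUpToIso_hom (coprodIsCoprod M linftyCircle) _ ⟨WalkingPair.left⟩

theorem inr_coprodIsoTensor (M : CommWStar) :
    coprod.inr ≫ (coprodIsoTensor T hT M).hom = ObjectProperty.homMk (T M.obj).inr :=
  IsColimit.comp_coconePointUniqueUpToIso_hom (coprodIsCoprod M linftyCircle) _ ⟨WalkingPair.right⟩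

theorem coprodIsoTensor_naturality {M M' : CommWStar} (g : M ⟶ M') :
    coprod.map g (𝟙 linftyCircle) ≫ (coprodIsoTensor T hT M').hom =
      (coprodIsoTensor T hT M).hom ≫ (tensorRight T hT).map g := by
  apply coprod.hom_ext
  · refine (coprod.inl_map_assoc _ _ _).trans ((congrArg (g ≫ ·)
      (inl_coprodIsoTensor T hT M')).trans (Eq.trans ?_ ((Category.assoc _ _ _).symm.trans
        (congrArg (· ≫ (tensorRight T hT).map g) (inl_coprodIsoTensor T hT M))).symm))
    exact ObjectProperty.hom_ext _ ((T M.obj).inl_mapLeft (T M'.obj) g.hom).symm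
  · refine (coprod.inr_map_assoc _ _ _).trans ((Category.id_comp _).trans
      ((inr_coprodIsoTensor T hT M').trans (Eq.trans ?_ ((Category.assoc _ _ _).symm.trans
        (congrArg (· ≫ (tensorRight T hT).map g) (inr_coprodIsoTensor T hT M))).symm)))
    exact ObjectProperty.hom_ext _ ((T M.obj).inr_mapLeft (T M'.obj) g.hom).symm

/-- The functor `- ⨿ L^∞(𝕋)` is the functor `- ⊗ L^∞(𝕋)`. -/
def coprodIsoTensorRight : coprod.functor.flip.obj linftyCircle ≅ tensorRight T hT :=
  NatIso.ofComponents (coprodIsoTensor T hT) (coprodIsoTensor_naturality T hT)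

end

end CommWStar

/-! ### Coexponentials and the theorem -/

/-- A coexponential of `Z` is an initial object among the arrows from `Z` to the functor `- ⨿ Y`;
having one for every `Z` amounts to a left adjoint. -/
theorem isRightAdjoint_of_hasCoexponential {C : Type*} [Category C] [HasBinaryCoproducts C] (Y : C)
    (h : ∀ Z, HasCoexponential Y Z) : (coprod.functor.flip.obj Y : C ⥤ C).IsRightAdjoint := by
  have : ∀ Z, HasInitial (StructuredArrow Z (coprod.functor.flip.obj Y : C ⥤ C)) := fun Z => by
    obtain ⟨E, e, he⟩ := h Z
    let I : StructuredArrow Z (coprod.functor.flip.obj Y : C ⥤ C) := StructuredArrow.mk (Y := E) e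
    refine IsInitial.hasInitial (X := I) (IsInitial.ofUniqueHom (fun A =>
      StructuredArrow.homMk (he A.right A.hom).choose (he A.right A.hom).choose_spec.1) ?_)
    intro A m
    apply StructuredArrow.ext
    exact (he A.right A.hom).unique (StructuredArrow.w m) (he A.right A.hom).choose_spec.1
  exact isRightAdjointOfStructuredArrowInitials _

end

theorem mainTheorem6 :
    -- categorical tensor products exist, and those of commutative algebras are commutative
    (∀ M N : WStar, Nonempty (WStar.CategoricalTensor M N)) ∧
    (∀ (M N : WStar) (T : WStar.CategoricalTensor M N),
      WStar.isCommutative M → WStar.isCommutative N → WStar.isCommutative T.pt) ∧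
    -- `ℂ` is the equalizer of an irrational rotation with the identity, in both categories
    (∀ θ : ℝ, Irrational θ →
      Nonempty (IsLimit (WStar.rotationFork (Circle.exp (2 * Real.pi * θ)))) ∧
      Nonempty (IsLimit (CommWStar.rotationFork (Circle.exp (2 * Real.pi * θ))))) ∧
    -- the functor `- ⊗ L^∞(𝕋, λ)` on W*-algebras, and its restriction to commutative ones
    (∀ T : ∀ M, WStar.CategoricalTensor M WStar.linftyCircle,
      ((∀ θ : ℝ, Irrational θ →
          IsEmpty (IsLimit (mapFork (WStar.tensorRight T)
            (WStar.rotationFork (Circle.exp (2 * Real.pi * θ)))))) ∧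
        ¬ PreservesLimitsOfShape WalkingParallelPair (WStar.tensorRight T) ∧
        ¬ PreservesLimits (WStar.tensorRight T) ∧
        ¬ (WStar.tensorRight T).IsRightAdjoint) ∧
      ∃ hT : ∀ M, WStar.isCommutative M → WStar.isCommutative (T M).pt,
        (∀ θ : ℝ, Irrational θ →
          IsEmpty (IsLimit (mapFork (CommWStar.tensorRight T hT)
            (CommWStar.rotationFork (Circle.exp (2 * Real.pi * θ)))))) ∧
        ¬ PreservesLimitsOfShape WalkingParallelPair (CommWStar.tensorRight T hT) ∧
        ¬ PreservesLimits (CommWStar.tensorRight T hT) ∧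
        ¬ (CommWStar.tensorRight T hT).IsRightAdjoint) ∧
    -- commutative W*-algebras have coproducts but fail to have all coexponentials
    (∃ _ : HasBinaryCoproducts CommWStar,
      ∃ Z : CommWStar, ¬ HasCoexponential CommWStar.linftyCircle Z) := by
  have hcomm : ∀ (M N : WStar) (T : WStar.CategoricalTensor M N),
      WStar.isCommutative M → WStar.isCommutative N → WStar.isCommutative T.pt :=
    fun _ _ T hM hN => T.isCommutative_pt hM hN
  have hT : ∀ (T : ∀ M, WStar.CategoricalTensor M WStar.linftyCircle) (M : WStar),
      WStar.isCommutative M → WStar.isCommutative (T M).pt :=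
    fun T M hM => hcomm _ _ (T M) hM WStar.isCommutative_linftyCircle
  have hW := fun T : ∀ M, WStar.CategoricalTensor M WStar.linftyCircle =>
    not_preserves_of_isEmpty_isLimit_mapFork (WStar.tensorRight T)
      -- A single irrational angle is enough to refute preservation.
      (WStar.nonempty_isLimit_rotationFork irrational_sqrt_two)
      (WStar.isEmpty_isLimit_mapFork T irrational_sqrt_two)
  have hC := fun T : ∀ M, WStar.CategoricalTensor M WStar.linftyCircle =>
    not_preserves_of_isEmpty_isLimit_mapFork (CommWStar.tensorRight T (hT T))
      (CommWStar.nonempty_isLimit_rotationFork irrational_sqrt_two)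
      (CommWStar.isEmpty_isLimit_mapFork T (hT T) irrational_sqrt_two)
  refine ⟨WStar.nonempty_categoricalTensor, hcomm, fun θ hθ =>
    ⟨WStar.nonempty_isLimit_rotationFork hθ, CommWStar.nonempty_isLimit_rotationFork hθ⟩,
    fun T => ⟨⟨fun θ hθ => WStar.isEmpty_isLimit_mapFork T hθ, hW T⟩, hT T,
      fun θ hθ => CommWStar.isEmpty_isLimit_mapFork T (hT T) hθ, hC T⟩,
    CommWStar.hasBinaryCoproducts, ?_⟩
  have := CommWStar.hasBinaryCoproducts
  -- No explicit `Z` is produced: coexponentials for all `Z` would make `- ⨿ L^∞(𝕋)`, hence the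
  -- isomorphic functor `- ⊗ L^∞(𝕋)`, a right adjoint.
  by_contra! hall
  let T : ∀ M, WStar.CategoricalTensor M WStar.linftyCircle :=
    fun M => (WStar.nonempty_categoricalTensor M _).some
  have := isRightAdjoint_of_hasCoexponential CommWStar.linftyCircle hall
  exact (hC T).2.2 (Functor.isRightAdjoint_of_iso (CommWStar.coprodIsoTensorRight T (hT T)))
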